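/- Let $M$ be a smooth ($C^\infty$) manifold of dimension $n$, let $U\subseteq M$ be a coordinate neighborhood that is diffeomorphic to $\mathbb R^n$, and let $X\mapsto S_X$ be an arbitrary map (not assumed linear in $X$) from the smooth vector fields on $U$ to the smooth tensor fields of type $(1,1)$ on $U$. Let $D$ be the corresponding $S$-derivation, which assigns to every smooth vector field $X$ on $U$ the derivation $D_X=L_X+S_X$ of the tensor algebra over $U$; here $L_X$ is the Lie derivative, and $S_X$ acts as the type-preserving derivation of the tensor algebra that commutes with contractions, is zero on functions and is $Y\mapsto S_X(Y)$ on vector fields. Thus $D_Xf=X(f)$ on functions and $D_XY=[X,Y]+S_X(Y)$ on vector fields. The curvature of $D$ is $R^D(X,Y)=D_XD_Y-D_YD_X-D_{[X,Y]}$, acting on all smooth tensor fields, and $D$ is flat if $R^D=0$. The components of $D_X$ in a basis (frame) $E_1,\dots,E_n$ of smooth vector fields on $U$ are the functions $(W_X)^i_j$ with $D_XE_j=\sum_i (W_X)^i_jE_i$. Then the following are equivalent: (a) $D$ is a flat linear connection on $U$, i.e. $R^D=0$ and there is a covariant derivative $\nabla$ on the tangent bundle of $U$ with $D_XY=\nabla_XY$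 for all smooth vector fields $X,Y$ on $U$; (b) $R^D=0$, and $D_X=0$ where $X=0$: for every smooth vector field $X$ on $U$ and every $x\in U$ with $X_x=0$, one has $(D_XT)_x=0$ for every smooth tensor field $T$ on $U$; (c) there is a basis $E_1,\dots,E_n$ of smooth vector fields on $U$ in which the components $W_X$ of $D_X$ vanish identically on $U$ for every smooth vector field $X$ on $U$. -/

import Mathlib

open Set TopologicalSpace Bundle VectorField
open scoped Manifold ContDiff

noncomputable section

namespace SDeriv

/-! ### Derivations of modules over a ring with a derivation -/

/-- An additive operator on the `A`-module `N` obeying the Leibniz rule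
`δ (f • m) = d f • m + f • δ m` over a given operator `d` on the ring `A`. -/
structure LeibnizOp {A : Type*} [CommRing A] (d : A → A) (N : Type*) [AddCommGroup N]
    [Module A N] where
  /-- the underlying operator -/
  toFun : N → N
  map_add : ∀ m m', toFun (m + m') = toFun m + toFun m'
  leibniz : ∀ (f : A) (m : N), toFun (f • m) = d f • m + f • toFun m

namespace LeibnizOp

variable {A : Type*} [CommRing A] {d : A → A}
  {N : Type*} [AddCommGroup N] [Module A N] {P : Type*} [AddCommGroup P] [Module A P]

instance : CoeFun (LeibnizOp d N) (fun _ => N → N) := ⟨LeibnizOp.toFun⟩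

/-- The induced operator on linear maps, `(δ α) m = δ (α m) - α (δ m)`. -/
def hom (δN : LeibnizOp d N) (δP : LeibnizOp d P) : LeibnizOp d (N →ₗ[A] P) where
  toFun α :=
    { toFun := fun m => δP (α m) - α (δN m)
      map_add' := fun m m' => by simp only [_root_.map_add, δN.map_add, δP.map_add]; abel
      map_smul' := fun f m => by
        simp only [_root_.map_add, map_smul, δN.leibniz, δP.leibniz,
          RingHom.id_apply, smul_sub]
        abel }
  map_add α α' := by
    ext m; simp only [LinearMap.add_apply, LinearMap.coe_mk, AddHom.coe_mk, δP.map_add]; abel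
  leibniz f α := by
    ext m
    simp only [LinearMap.add_apply, LinearMap.smul_apply, LinearMap.coe_mk, AddHom.coe_mk,
      δP.leibniz, smul_sub]
    abel

/-- The induced operator on multilinear maps,
`(δ T) (m₁, …, m_k) = δ (T (m₁, …, m_k)) - ∑ i, T (m₁, …, δ m_i, …, m_k)`. -/
def multilinear (k : ℕ) (δN : LeibnizOp d N) (δP : LeibnizOp d P) :
    LeibnizOp d (MultilinearMap A (fun _ : Fin k => N) P) where
  toFun T :=
    { toFun := fun m => δP (T m) - ∑ i, T (Function.update m i (δN (m i)))
      map_update_add' := by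
        intro inst m i x y
        obtain rfl := Subsingleton.elim inst (instDecidableEqFin k)
        have key : ∀ j, T (Function.update (Function.update m i (x + y)) j
              (δN (Function.update m i (x + y) j))) =
            T (Function.update (Function.update m i x) j (δN (Function.update m i x j))) +
            T (Function.update (Function.update m i y) j (δN (Function.update m i y j))) := by
          intro j
          by_cases h : j = i
          · subst h; simp [δN.map_add]
          · simp [Function.update_of_ne h, Function.update_comm (Ne.symm h)]
        simp only [key, Finset.sum_add_distrib, T.map_update_add, δP.map_add]
        abel
      map_update_smul' := by
        intro inst m i f x
        obtain rfl := Subsingleton.elim inst (instDecidableEqFin k)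
        have key : ∀ j, T (Function.update (Function.update m i (f • x)) j
              (δN (Function.update m i (f • x) j))) =
            f • T (Function.update (Function.update m i x) j (δN (Function.update m i x j))) +
            (if j = i then d f • T (Function.update m i x) else 0) := by
          intro j
          by_cases h : j = i
          · subst h; simp [δN.leibniz, add_comm]
          · simp [Function.update_comm (Ne.symm h), h]
        simp only [key, Finset.sum_add_distrib, T.map_update_smul, δP.leibniz, smul_sub,
          Finset.smul_sum, Finset.sum_ite_eq', Finset.mem_univ, if_true]
        abel }
  map_add T T' := by
    ext m
    simp only [add_apply, MultilinearMap.coe_mk, δP.map_add,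
      Finset.sum_add_distrib]
    abel
  leibniz f T := by
    ext m
    simp only [add_apply, smul_apply, MultilinearMap.coe_mk,
      δP.leibniz, smul_sub, Finset.smul_sum]
    abel

end LeibnizOp

/-! ### Functions, vector fields and tensor fields on a smooth manifold -/

section Fields

variable (n : ℕ) (M : Type*) [TopologicalSpace M] [ChartedSpace (EuclideanSpace ℝ (Fin n)) M]

/-- Smooth real functions on the `n`-manifold `M`. -/
abbrev SmoothFun := C^∞⟮𝓡 n, M; ℝ⟯

variable [IsManifold (𝓡 n) ∞ M]

/-- Smooth vector fields on `M`. -/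
abbrev VField := Cₛ^∞⟮𝓡 n; EuclideanSpace ℝ (Fin n), (TangentSpace (𝓡 n) : M → Type _)⟯

/-- Smooth tensor fields of type (1,1), as fields of endomorphisms of the tangent spaces. -/
abbrev EndField := Cₛ^∞⟮𝓡 n; EuclideanSpace ℝ (Fin n) →L[ℝ] EuclideanSpace ℝ (Fin n),
  (fun x : M => TangentSpace (𝓡 n) x →L[ℝ] TangentSpace (𝓡 n) x)⟯

variable {n M}

instance : SMul (SmoothFun n M) (VField n M) where
  smul f X := ⟨fun x => f x • X x, f.contMDiff.smul_section X.contMDiff⟩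

@[simp] theorem smul_apply (f : SmoothFun n M) (X : VField n M) (x : M) :
    (f • X) x = f x • X x := rfl

/-- Vector fields form a module over the ring of smooth functions, pointwise. -/
instance : Module (SmoothFun n M) (VField n M) where
  one_smul X := by ext x; simp
  mul_smul f g X := by ext x; simp [mul_smul]
  smul_zero f := by ext x; simp
  smul_add f X Y := by ext x; simp
  add_smul f g X := by ext x; simp [add_smul]
  zero_smul X := by ext x; simp

/-- The action `X(f)` of a vector field on a function. -/
def act (X : VField n M) (f : SmoothFun n M) : SmoothFun n M :=
  ⟨fun x => mvfderiv (𝓡 n) f x (X x), by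
    have h := (f.contMDiff.contMDiff_tangentMap (m := ∞) (by simp)).comp X.contMDiff
    exact (contMDiff_snd_tangentBundle_modelSpace ℝ 𝓘(ℝ, ℝ)).comp h⟩

@[simp] theorem act_apply (X : VField n M) (f : SmoothFun n M) (x : M) :
    act X f x = mvfderiv (𝓡 n) f x (X x) := rfl

/-- The Lie bracket `[X, Y]`. -/
def bracket (X Y : VField n M) : VField n M :=
  ⟨mlieBracket (𝓡 n) X Y, fun x =>
    have : IsManifold (𝓡 n) (((⊤ : ℕ∞) : WithTop ℕ∞) + 1) M :=
      inferInstanceAs (IsManifold (𝓡 n) ∞ M)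
    have : IsManifold (𝓡 n) (minSmoothness ℝ 2) M := by
      rw [minSmoothness_of_isRCLikeNormedField]; infer_instance
    ContMDiffAt.mlieBracket_vectorField (m := ⊤) (n := ⊤) X.contMDiff.contMDiffAt
      Y.contMDiff.contMDiffAt (by simp)⟩

@[simp] theorem bracket_apply (X Y : VField n M) (x : M) :
    bracket X Y x = mlieBracket (𝓡 n) X Y x := rfl

/-- The value of a tensor field of type (1,1) on a vector field. -/
def EndField.app (S : EndField n M) (Y : VField n M) : VField n M :=
  ⟨fun x => S x (Y x), fun x => ContMDiffAt.clm_bundle_apply (𝕜 := ℝ)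
    (F₁ := EuclideanSpace ℝ (Fin n)) (F₂ := EuclideanSpace ℝ (Fin n))
    (E₁ := (TangentSpace (𝓡 n) : M → Type _)) (E₂ := (TangentSpace (𝓡 n) : M → Type _))
    (b := fun y : M => y) (S.contMDiff x) (Y.contMDiff x)⟩

@[simp] theorem EndField.app_apply (S : EndField n M) (Y : VField n M) (x : M) :
    S.app Y x = S x (Y x) := rfl

variable (n M)

/-- One-forms, as function-linear maps from vector fields to functions. -/
abbrev OneForm := VField n M →ₗ[SmoothFun n M] SmoothFun n M

/-- Tensor fields of type `(p, q)`, as function-multilinear maps in `p` one-forms and `q` vector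
fields. -/
abbrev TensorField (p q : ℕ) :=
  MultilinearMap (SmoothFun n M) (fun _ : Fin p => OneForm n M)
    (MultilinearMap (SmoothFun n M) (fun _ : Fin q => VField n M) (SmoothFun n M))

/-! ### `S`-derivations -/

/-- An `S`-derivation `D : X ↦ D_X = L_X + S_X`. It is given by an arbitrary map `X ↦ S_X` from
vector fields to tensor fields of type (1,1); no linearity in `X` is required. -/
structure SDerivation where
  /-- the map `X ↦ S_X` -/
  S : VField n M → EndField n M

variable {n M}

namespace SDerivation

variable (D : SDerivation n M)

/-- `D_X` on functions: `D_X f = X(f)`. -/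
def onFun (X : VField n M) : LeibnizOp (act X) (SmoothFun n M) where
  toFun := act X
  map_add f g := by
    ext x
    have hf := f.contMDiff.mdifferentiableAt (x := x) (by simp)
    have hg := g.contMDiff.mdifferentiableAt (x := x) (by simp)
    simp only [act_apply, ContMDiffMap.coe_add, Pi.add_apply]
    rw [mvfderiv_add hf hg]; rfl
  leibniz f g := by
    ext x
    have hf := f.contMDiff.mdifferentiableAt (x := x) (by simp)
    have hg := g.contMDiff.mdifferentiableAt (x := x) (by simp)
    simp only [smul_eq_mul, act_apply, ContMDiffMap.coe_add, ContMDiffMap.coe_mul, Pi.add_apply,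
      Pi.mul_apply]
    rw [mvfderiv_mul hf hg]
    simp [mul_comm, add_comm]

/-- `D_X` on vector fields: `D_X Y = [X, Y] + S_X Y`. -/
def onVField (X : VField n M) : LeibnizOp (act X) (VField n M) where
  toFun Y := bracket X Y + (D.S X).app Y
  map_add Y Z := by
    ext x
    have h := mlieBracket_add_right (I := 𝓡 n) (V := X) (Y.mdifferentiableAt (x := x))
      (Z.mdifferentiableAt (x := x))
    simp only [ContMDiffSection.coe_add, Pi.add_apply, bracket_apply, EndField.app_apply, map_add]
    rw [h]; abel
  leibniz f Y := by
    ext x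
    have hf := f.contMDiff.mdifferentiableAt (x := x) (by simp)
    have h := mlieBracket_smul_right (I := 𝓡 n) (V := X) hf (Y.mdifferentiableAt (x := x))
    have e : (⇑(f • Y) : Π x : M, TangentSpace (𝓡 n) x) = (⇑f) • (⇑Y) := rfl
    simp only [ContMDiffSection.coe_add, Pi.add_apply, bracket_apply, EndField.app_apply,
      smul_apply, map_smul, act_apply, e, h, smul_add]
    abel

/-- `D_X` on tensor fields of type `(p, q)`: the extension of `L_X + S_X` as a derivation of the
tensor algebra commuting with contractions,
`(D_X T)(α, Y) = X(T(α, Y)) - ∑ a, T(…, D_X α_a, …, Y) - ∑ b, T(α, …, D_X Y_b, …)`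
where `(D_X α)(Y) = X(α(Y)) - α(D_X Y)`. -/
def onTensor (p q : ℕ) (X : VField n M) : LeibnizOp (act X) (TensorField n M p q) :=
  LeibnizOp.multilinear p (LeibnizOp.hom (D.onVField X) (onFun X))
    (LeibnizOp.multilinear q (D.onVField X) (onFun X))

/-- The curvature operator `R^D(X, Y) = D_X D_Y - D_Y D_X - D_[X,Y]` on tensor fields. -/
def curvature (X Y : VField n M) {p q : ℕ} (T : TensorField n M p q) : TensorField n M p q :=
  D.onTensor p q X (D.onTensor p q Y T) - D.onTensor p q Y (D.onTensor p q X T)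
    - D.onTensor p q (bracket X Y) T

/-- `R^D = 0`. -/
def IsFlat : Prop :=
  ∀ (X Y : VField n M) (p q : ℕ) (T : TensorField n M p q), D.curvature X Y T = 0

/-- `D_X = 0` where `X = 0`: at each point at which `X` vanishes, so does `D_X T` for every
tensor field `T`. -/
def VanishesWithField : Prop :=
  ∀ (X : VField n M) (x : M), X x = 0 → ∀ (p q : ℕ) (T : TensorField n M p q)
    (α : Fin p → OneForm n M) (Y : Fin q → VField n M), (D.onTensor p q X T) α Y x = 0

/-- `D` is a linear connection: `D_X` is the covariant differentiation along `X` of some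
covariant derivative on the tangent bundle, for every `X`. -/
def IsLinearConnection : Prop :=
  ∃ cov : CovariantDerivative (𝓡 n) (EuclideanSpace ℝ (Fin n))
      (TangentSpace (𝓡 n) : M → Type _),
    ∀ (X Y : VField n M) (x : M), D.onVField X Y x = cov Y x (X x)

end SDerivation

/-- `(E 1, …, E n)` is a basis (frame) of vector fields on the whole of `M`. -/
abbrev IsFrame (E : Fin n → VField n M) : Prop :=
  IsLocalFrameOn (𝓡 n) (EuclideanSpace ℝ (Fin n)) ∞ (fun i => ⇑(E i)) univ

/-- The components of `D_X` in the basis `E`, defined by `D_X E_j = ∑ i, (W_X)^i_j E_i`. -/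
def SDerivation.components (D : SDerivation n M) {E : Fin n → VField n M} (hE : IsFrame E)
    (X : VField n M) (i j : Fin n) (x : M) : ℝ :=
  hE.coeff i x (D.onVField X (E j) x)

end Fields

end SDeriv

end

/-!
The implication from (b) to (c) carries the weight; the map `X ↦ S_X` is not assumed linear.

Let `∂ᵢ` be the coordinate fields. Since `[∂ᵢ, ∂ⱼ] = 0` and `D_0 = 0`, flatness makes the operators
`D_{∂ᵢ}` commute, so their connection form in the chart has zero curvature (`connForm_flat`). A flat
connection on a vector space has a global parallel frame: parallel transport along rays, together
with Grönwall's inequality, gives sections that are differentiable and parallel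
(`exists_parallel_section`), and the equation `ds = -A s` makes them smooth. This yields a frame `E`
with `D_{∂ᵢ} Eⱼ = 0` (`exists_parallel_frame`).

Now `D_X Eⱼ = 0` for every field `X` and at every point `p` (`onVField_eq_zero_of_parallel`). Write
`E` for `Eⱼ`, let `Z` be the radial field at `p`, and choose `F` with `[∂₁, F] = X`. As `Z` vanishes
at `p` and `[∂ₖ, Z] = ∂ₖ`, the field `D_Z E` is parallel and zero at `p`, hence zero, so that
`D_Z D_F E = D_{[Z, F]} E`. Apply `D_{∂₁}` and evaluate at `p`. The right side becomes
`D_{[∂₁, [Z, F]]} E`, which is zero at `p` because `[∂₁, [Z, F]]` vanishes there. The left side is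
`D_Z D_{∂₁} D_F E + D_{[∂₁, Z]} D_F E`, whose first term vanishes at `p` with `Z` and whose second
term is `D_{∂₁} D_F E = D_{[∂₁, F]} E = D_X E`.

For (c) to (a), the curvature, and the difference of `D_X` and the connection that agrees with `D`
on the `∂ᵢ`, are function-linear on vector fields and vanish on the frame, hence everywhere
(`eq_zero_of_frame`). The conditions on all tensor fields reduce to vector fields
(`isFlat_iff`, `vanishesWithField_iff`), and (a) to (b) is then immediate.
-/

noncomputable section

namespace SDeriv

set_option maxSynthPendingDepth 3

/-! ### Linear differential equations on the unit interval -/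

section LinearODE

variable {F : Type*} [NormedAddCommGroup F] [NormedSpace ℝ F]

/-- The weight `exp (-l t)` makes the Volterra operator have norm at most `C / l`, hence a
contraction once `l > C`. -/
theorem norm_integral_exp_smul_le {B : ℝ → F} {l C t : ℝ} (hl : 0 < l) (ht : t ∈ Icc (0 : ℝ) 1)
    (hB : ∀ s ∈ Icc (0 : ℝ) 1, ‖B s‖ ≤ C) :
    ‖Real.exp (-(l * t)) • ∫ s in (0 : ℝ)..t, Real.exp (l * s) • B s‖ ≤ C / l := by
  have hC : 0 ≤ C := (norm_nonneg _).trans (hB 0 (by simp))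
  have hd : ∀ s : ℝ, HasDerivAt (fun s => Real.exp (l * s) * (C / l)) (Real.exp (l * s) * C) s := by
    intro s
    have := (((hasDerivAt_id s).const_mul l).exp).mul_const (C / l)
    refine this.congr_deriv ?_
    have : l ≠ 0 := hl.ne'
    simp only [id_eq, mul_one]
    field_simp
  have hI : ∫ s in (0 : ℝ)..t, Real.exp (l * s) * C
      = Real.exp (l * t) * (C / l) - Real.exp (l * 0) * (C / l) :=
    intervalIntegral.integral_eq_sub_of_hasDerivAt (fun s _ => hd s)
      (Continuous.intervalIntegrable (by fun_prop) _ _)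
  have h1 : ‖∫ s in (0 : ℝ)..t, Real.exp (l * s) • B s‖ ≤ ∫ s in (0 : ℝ)..t, Real.exp (l * s) * C := by
    refine intervalIntegral.norm_integral_le_of_norm_le ht.1 ?_
      (Continuous.intervalIntegrable (by fun_prop) _ _)
    refine Filter.Eventually.of_forall fun s hs => ?_
    rw [norm_smul, Real.norm_eq_abs, Real.abs_exp]
    gcongr
    exact hB s ⟨hs.1.le, hs.2.trans ht.2⟩
  rw [norm_smul, Real.norm_eq_abs, Real.abs_exp]
  calc _ ≤ Real.exp (-(l * t)) * (Real.exp (l * t) * (C / l)) := by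
        gcongr
        refine h1.trans (hI.le.trans ?_)
        have : 0 ≤ Real.exp (l * 0) * (C / l) := by positivity
        linarith
    _ = C / l := by rw [← mul_assoc, ← Real.exp_add]; simp

/-- A linear differential equation `y' = B t y` has a solution on the whole unit interval. The fixed
point of the contraction is `z t = exp (-l t) • y t`, continuous functions on `[0, 1]` being extended
to `ℝ` by constants. -/
theorem exists_hasDerivAt_linear_Icc [CompleteSpace F] {B : ℝ → F →L[ℝ] F} (hB : Continuous B)
    (y₀ : F) : ∃ y : ℝ → F, y 0 = y₀ ∧ ∀ t ∈ Icc (0 : ℝ) 1, HasDerivAt y (B t (y t)) t := by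
  obtain ⟨C, hC⟩ := (isCompact_Icc (a := (0 : ℝ)) (b := 1)).exists_bound_of_continuousOn
    hB.continuousOn
  have hC0 : 0 ≤ C := (norm_nonneg _).trans (hC 0 (by simp))
  -- Any `l ≥ 2 C` makes the contraction constant at most `1 / 2`.
  set l : ℝ := 2 * C + 1 with hl
  have hl0 : 0 < l := by positivity
  let e : C(Icc (0 : ℝ) 1, F) → ℝ → F := fun z => IccExtend zero_le_one z
  have he : ∀ z, Continuous (e z) := fun z => z.continuous.Icc_extend'
  let T : C(Icc (0 : ℝ) 1, F) → C(Icc (0 : ℝ) 1, F) := fun z =>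
    ⟨fun t => Real.exp (-(l * t)) • (y₀ + ∫ s in (0 : ℝ)..t, Real.exp (l * s) • B s (e z s)), by
      have hc : Continuous fun s => Real.exp (l * s) • B s (e z s) := by
        have := he z
        fun_prop
      have := intervalIntegral.continuous_primitive
        (fun a b => hc.intervalIntegrable (μ := MeasureTheory.volume) a b) 0
      fun_prop⟩
  have hT : ContractingWith (1 / 2) T := by
    refine ⟨by rw [← NNReal.coe_lt_coe]; norm_num, LipschitzWith.of_dist_le_mul fun z z' => ?_⟩
    rw [ContinuousMap.dist_le (by positivity)]
    intro t
    have hsub : T z t - T z' t = Real.exp (-(l * t)) •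
        ∫ s in (0 : ℝ)..t, Real.exp (l * s) • B s (e z s - e z' s) := by
      have := he z
      have := he z'
      simp only [T, ContinuousMap.coe_mk, ← smul_sub, map_sub]
      simp only [smul_sub]
      rw [intervalIntegral.integral_sub]
      · simp [← smul_sub]
      all_goals exact Continuous.intervalIntegrable (by fun_prop) _ _
    rw [dist_eq_norm, hsub]
    refine (norm_integral_exp_smul_le (C := C * dist z z') hl0 t.2 fun s hs => ?_).trans ?_
    · refine (B s).le_opNorm_of_le ?_ |>.trans (mul_le_mul_of_nonneg_right (hC s hs) dist_nonneg)
      simp only [e, IccExtend, Function.comp, ← dist_eq_norm]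
      exact ContinuousMap.dist_apply_le_dist _
    · rw [div_le_iff₀ hl0]
      have := dist_nonneg (x := z) (y := z')
      simp only [NNReal.coe_div, NNReal.coe_one, NNReal.coe_ofNat]
      nlinarith
  obtain ⟨z, hz⟩ : ∃ z, T z = z := ⟨_, hT.fixedPoint_isFixedPt⟩
  have hcont : Continuous fun s => Real.exp (l * s) • B s (e z s) := by
    have := he z
    fun_prop
  have hy : ∀ t ∈ Icc (0 : ℝ) 1, y₀ + ∫ s in (0 : ℝ)..t, Real.exp (l * s) • B s (e z s)
      = Real.exp (l * t) • e z t := by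
    intro t ht
    have h1 : e z t = z ⟨t, ht⟩ := IccExtend_of_mem _ _ ht
    have h2 := congrArg (fun w => w ⟨t, ht⟩) hz
    rw [h1, ← h2]
    simp only [T, ContinuousMap.coe_mk, smul_smul, ← Real.exp_add]
    simp
  refine ⟨fun t => y₀ + ∫ s in (0 : ℝ)..t, Real.exp (l * s) • B s (e z s), by simp, fun t ht => ?_⟩
  have h := (hcont.integral_hasStrictDerivAt 0 t).hasDerivAt.const_add y₀
  beta_reduce
  rw [hy t ht, map_smul]
  exact h

theorem eq_zero_of_hasDerivAt_linear {B : ℝ → F →L[ℝ] F} (hB : Continuous B) {y : ℝ → F}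
    (hy : ∀ t, HasDerivAt y (B t (y t)) t) (h0 : y 0 = 0) : y 1 = 0 := by
  obtain ⟨C, hC⟩ := (isCompact_Icc (a := (0 : ℝ)) (b := 1)).exists_bound_of_continuousOn
    hB.continuousOn
  refine eq_zero_of_abs_deriv_le_mul_abs_self_of_eq_zero_right (K := C) (a := 0) (b := 1)
    (fun t _ => (hy t).continuousAt.continuousWithinAt) (fun t _ => (hy t).hasDerivWithinAt) h0
    (fun t ht => ?_) 1 (by simp)
  exact (B t).le_of_opNorm_le (hC t ⟨ht.1, ht.2.le⟩) _

end LinearODE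

/-! ### Flat sections of a trivial bundle over a vector space -/

section ParallelSection

variable {V : Type*} [NormedAddCommGroup V] [NormedSpace ℝ V]
  {F : Type*} [NormedAddCommGroup F] [NormedSpace ℝ F]

/-- If `f (t, ·)` vanishes to first order at `0` for every `t`, then it is `o(‖h‖)` uniformly in
`t ∈ [0, 1]`, by compactness and the mean value inequality. -/
theorem eventually_norm_le_mul_norm_of_fderiv_zero {G : Type*} [NormedAddCommGroup G]
    [NormedSpace ℝ G] {f : ℝ × V → G} (hf : ContDiff ℝ 1 f) (h0 : ∀ t, f (t, 0) = 0)
    (h1 : ∀ t, HasFDerivAt (fun h => f (t, h)) (0 : V →L[ℝ] G) 0) {ε : ℝ} (hε : 0 < ε) :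
    ∀ᶠ h in nhds (0 : V), ∀ t ∈ Icc (0 : ℝ) 1, ‖f (t, h)‖ ≤ ε * ‖h‖ := by
  let f' : ℝ × V → V →L[ℝ] G := fun p => (fderiv ℝ f p).comp (ContinuousLinearMap.inr ℝ ℝ V)
  have hf' : ∀ t h, HasFDerivAt (fun h => f (t, h)) (f' (t, h)) h := fun t h =>
    ((hf.differentiable (by simp)) (t, h)).hasFDerivAt.comp h (hasFDerivAt_prodMk_right t h)
  have hc : Continuous f' := (hf.continuous_fderiv (by simp)).clm_comp continuous_const
  have hz : ∀ t, f' (t, 0) = 0 := fun t => (hf' t 0).unique (h1 t)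
  have hev : ∀ᶠ h in nhds (0 : V), ∀ t ∈ Icc (0 : ℝ) 1, ‖f' (t, h)‖ < ε := by
    refine isCompact_Icc.eventually_forall_of_forall_eventually fun t _ => ?_
    have hc' : Continuous fun z : V × ℝ => ‖f' (z.2, z.1)‖ := by fun_prop
    refine hc'.continuousAt.eventually_lt continuousAt_const ?_
    simpa [hz] using hε
  obtain ⟨δ, hδ, hb⟩ := Metric.eventually_nhds_iff_ball.1 hev
  filter_upwards [Metric.ball_mem_nhds (0 : V) hδ] with h hh t ht
  have := (convex_ball (0 : V) δ).norm_image_sub_le_of_norm_hasFDerivWithin_le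
    (f := fun h => f (t, h)) (fun x _ => (hf' t x).hasFDerivWithinAt)
    (fun x hx => (hb x hx t ht).le) (Metric.mem_ball_self hδ) hh
  simpa [h0] using this

/-- A flat connection `d + A` on a trivial bundle over a vector space has a parallel section through
every vector `w₀` at the origin. The section is obtained by parallel transport along rays, and
flatness shows that it is parallel in all directions. -/
theorem exists_parallel_section [CompleteSpace F] {A : V → V →L[ℝ] F →L[ℝ] F}
    (hA : ContDiff ℝ ∞ A)
    (flat : ∀ x u v w, fderiv ℝ A x u v w - fderiv ℝ A x v u w
      + A x u (A x v w) - A x v (A x u w) = 0) (w₀ : F) :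
    ∃ s : V → F, s 0 = w₀ ∧ ∀ x, HasFDerivAt s (-((A x).flip (s x))) x := by
  have hAc := hA.continuous
  have hdA : ContDiff ℝ ∞ (fderiv ℝ A) := hA.fderiv_right (by simp)
  have hdA' : ∀ x, HasFDerivAt A (fderiv ℝ A x) x := fun x =>
    (hA.differentiable (by simp) x).hasFDerivAt
  choose Φ hΦ0 hΦ using fun x : V => exists_hasDerivAt_linear_Icc
    (B := fun t => -(A (t • x) x)) (by fun_prop) w₀
  refine ⟨fun x => Φ x 1, ?_, fun x => ?_⟩
  · have hz : ∀ t ∈ Icc (0 : ℝ) 1, HasDerivAt (Φ 0) 0 t := fun t ht => by simpa using hΦ 0 t ht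
    beta_reduce
    rw [constant_of_has_deriv_right_zero (fun t ht => (hz t ht).continuousAt.continuousWithinAt)
      (fun t ht => (hz t ⟨ht.1, ht.2.le⟩).hasDerivWithinAt) 1 (by simp), hΦ0]
  generalize fderiv ℝ A = dA at hdA hdA' flat
  -- `Φ x` transports `w₀` along the ray through `x`. With `h = p.2`, the curve
  -- `Ψ t = Φ x t - t • A (t • x) h (Φ x t)` solves the transport equation along the ray through
  -- `x + h` up to the error `ℰ (t, h) (Φ x t)`.
  let ℰ : ℝ × V → F →L[ℝ] F := fun p =>
    -(A (p.1 • x) x) - A (p.1 • x) p.2 - p.1 • dA (p.1 • x) x p.2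
      + p.1 • (A (p.1 • x) p.2).comp (A (p.1 • x) x)
      + (A (p.1 • (x + p.2)) (x + p.2)).comp
        (ContinuousLinearMap.id ℝ F - p.1 • A (p.1 • x) p.2)
  have hE : ContDiff ℝ ∞ ℰ := by
    have h1 : ContDiff ℝ ∞ fun p : ℝ × V => A (p.1 • x) := hA.comp (by fun_prop)
    have h2 : ContDiff ℝ ∞ fun p : ℝ × V => A (p.1 • (x + p.2)) := hA.comp (by fun_prop)
    have h3 : ContDiff ℝ ∞ fun p : ℝ × V => dA (p.1 • x) := hdA.comp (by fun_prop)
    fun_prop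
  have hE1 : ∀ t, HasFDerivAt (fun h => ℰ (t, h)) (0 : V →L[ℝ] F →L[ℝ] F) 0 := by
    intro t
    have hd : DifferentiableAt ℝ (fun h => ℰ (t, h)) 0 :=
      (hE.differentiable (by simp)).comp (by fun_prop) 0
    convert hd.hasFDerivAt using 1
    ext k w
    have hk : HasDerivAt (fun r : ℝ => r • k) k 0 := by
      simpa using (hasDerivAt_id (0 : ℝ)).smul_const k
    have hline : HasDerivAt (fun r : ℝ => ℰ (t, r • k) w)
        (fderiv ℝ (fun h => ℰ (t, h)) 0 k w) 0 := by
      have h1 := hd.hasFDerivAt.comp_hasDerivAt_of_eq (0 : ℝ) hk (by simp)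
      simpa using h1.clm_apply (hasDerivAt_const (0 : ℝ) w)
    have hx : HasDerivAt (fun r : ℝ => x + r • k) k 0 := hk.const_add x
    have ha : HasDerivAt (fun r : ℝ => A (t • (x + r • k))) (dA (t • x) (t • k)) 0 := by
      have := (hdA' (t • x)).comp_hasDerivAt_of_eq (0 : ℝ) (hx.const_smul t) (by simp)
      exact this
    have hr : ∀ v : F, HasDerivAt (fun r : ℝ => r • v) v 0 := fun v => by
      simpa using (hasDerivAt_id (0 : ℝ)).smul_const v
    have hw : HasDerivAt (fun r : ℝ => w - r • t • A (t • x) k w) (-(t • A (t • x) k w)) 0 :=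
      (hr _).const_sub w
    have hexp := ((((hr (A (t • x) k w)).const_sub (-(A (t • x) x w))).sub
      (hr (t • dA (t • x) x k w))).add (hr (t • A (t • x) k (A (t • x) x w)))).add
        ((ha.clm_apply hx).clm_apply hw)
    have heq := hline.unique (hexp.congr_of_eventuallyEq (Filter.Eventually.of_forall fun r => by
      simp [ℰ, smul_comm r t, smul_sub]
      abel))
    rw [heq]
    -- The derivative of the error at `h = 0` is `t` times the curvature on `(k, x)`.
    have hfl := congrArg (t • ·) (flat (t • x) k x w)
    simp only [smul_add, smul_sub, smul_zero] at hfl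
    simp only [zero_smul, add_zero, sub_zero, map_smul, map_neg, _root_.add_apply,
      _root_.smul_apply, _root_.zero_apply]
    rw [← hfl]
    abel
  have hE0 : ∀ t, ℰ (t, 0) = 0 := fun t => by simp [ℰ]
  have hΨ : ∀ h, ∀ t ∈ Icc (0 : ℝ) 1, HasDerivAt (fun t => Φ x t - t • A (t • x) h (Φ x t))
      (ℰ (t, h) (Φ x t) - A (t • (x + h)) (x + h) (Φ x t - t • A (t • x) h (Φ x t))) t := by
    intro h t ht
    have hx : HasDerivAt (fun r : ℝ => r • x) x t := by
      simpa using (hasDerivAt_id t).smul_const x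
    have ha : HasDerivAt (fun r : ℝ => A (r • x)) (dA (t • x) x) t :=
      (hdA' (t • x)).comp_hasDerivAt t hx
    have := (hΦ x t ht).sub ((hasDerivAt_id t).smul
      ((ha.clm_apply (hasDerivAt_const t h)).clm_apply (hΦ x t ht)))
    refine this.congr_deriv ?_
    simp [ℰ]
    abel
  obtain ⟨m, hm⟩ := (isCompact_Icc (a := (0 : ℝ)) (b := 1)).exists_bound_of_continuousOn
    (f := Φ x) fun t ht => (hΦ x t ht).continuousAt.continuousWithinAt
  have hm0 : 0 ≤ m := (norm_nonneg _).trans (hm 0 (by simp))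
  obtain ⟨c, hc⟩ := (isCompact_Icc (a := (0 : ℝ)) (b := 1)).exists_bound_of_continuousOn
    (f := fun t : ℝ => A (t • x) x) (by fun_prop)
  have hc0 : 0 ≤ c := (norm_nonneg _).trans (hc 0 (by simp))
  let K : NNReal := ⟨c + 1, by positivity⟩
  have hK : (K : ℝ) = c + 1 := rfl
  have hlip : ∀ᶠ h in nhds (0 : V), ∀ t ∈ Icc (0 : ℝ) 1, ‖A (t • (x + h)) (x + h)‖ < K := by
    refine isCompact_Icc.eventually_forall_of_forall_eventually fun t ht => ?_
    have hc' : Continuous fun z : V × ℝ => ‖A (z.2 • (x + z.1)) (x + z.1)‖ := by fun_prop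
    refine hc'.continuousAt.eventually_lt continuousAt_const ?_
    have := hc t ht
    simp only [add_zero, hK]
    linarith
  rw [hasFDerivAt_iff_isLittleO_nhds_zero, Asymptotics.isLittleO_iff]
  intro ε hε
  set L : ℝ := (Real.exp K - 1) / K with hL
  have hL0 : 0 ≤ L := div_nonneg (by simp) K.2
  have hη : 0 < ε / (m * L + 1) := by positivity
  filter_upwards [hlip, eventually_norm_le_mul_norm_of_fderiv_zero (hE.of_le (by simp)) hE0 hE1 hη]
    with h hh herr
  -- Grönwall: `Φ (x + h) 1` and `Ψ 1 = Φ x 1 - A x h (Φ x 1)` differ by `o(‖h‖)`.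
  have hgr := dist_le_of_approx_trajectories_ODE_of_mem (a := 0) (b := 1) (K := K) (δ := 0)
    (εf := 0) (εg := ε / (m * L + 1) * ‖h‖ * m)
    (s := fun _ => univ) (v := fun t y => -(A (t • (x + h)) (x + h)) y)
    (f := Φ (x + h)) (g := fun t => Φ x t - t • A (t • x) h (Φ x t))
    (fun t ht => (ContinuousLinearMap.lipschitz (-(A (t • (x + h)) (x + h)))).weaken (by
      rw [← NNReal.coe_le_coe, coe_nnnorm, norm_neg]
      exact (hh t ⟨ht.1, ht.2.le⟩).le) |>.lipschitzOnWith)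
    (fun t ht => (hΦ (x + h) t ht).continuousAt.continuousWithinAt)
    (fun t ht => (hΦ (x + h) t ⟨ht.1, ht.2.le⟩).hasDerivWithinAt)
    (fun t ht => by simp) (fun _ _ => trivial)
    (fun t ht => (hΨ h t ht).continuousAt.continuousWithinAt)
    (fun t ht => (hΨ h t ⟨ht.1, ht.2.le⟩).hasDerivWithinAt)
    (fun t ht => by
      rw [dist_eq_norm, sub_neg_eq_add, sub_add_cancel]
      exact ((ℰ (t, h)).le_opNorm _).trans (mul_le_mul (herr t ⟨ht.1, ht.2.le⟩)
        (hm t ⟨ht.1, ht.2.le⟩) (norm_nonneg _) (by positivity)))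
    (fun _ _ => trivial) (by simp [hΦ0]) 1 (by simp)
  have hKne : (K : ℝ) ≠ 0 := by rw [hK]; positivity
  rw [gronwallBound_of_K_ne_0 hKne, dist_eq_norm] at hgr
  calc ‖Φ (x + h) 1 - Φ x 1 - (-((A x).flip (Φ x 1))) h‖
      = ‖Φ (x + h) 1 - (Φ x 1 - (1 : ℝ) • A ((1 : ℝ) • x) h (Φ x 1))‖ := by
        congr 1
        simp
        abel
    _ ≤ _ := hgr
    _ = ε * ‖h‖ * (m * L / (m * L + 1)) := by
        rw [hL]
        simp
        ring
    _ ≤ ε * ‖h‖ * 1 := by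
        gcongr
        rw [div_le_one (by positivity)]
        linarith
    _ = ε * ‖h‖ := mul_one _

variable {A : V → V →L[ℝ] F →L[ℝ] F} {s : V → F}

/-- The equation `ds = -A s` makes `s` one degree smoother than the lesser of the degrees of `A` and
`s`, so a differentiable parallel section is smooth. -/
theorem contDiff_parallel_section (hA : ContDiff ℝ ∞ A)
    (hs : ∀ x, HasFDerivAt s (-((A x).flip (s x))) x) : ContDiff ℝ ∞ s := by
  rw [contDiff_infty]
  intro k
  induction k with
  | zero => exact contDiff_zero.2 (continuous_iff_continuousAt.2 fun x => (hs x).continuousAt)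
  | succ k ih =>
    have hk : (((k : ℕ) : ℕ∞) : WithTop ℕ∞) ≤ ∞ := by exact_mod_cast le_top
    have hAk := hA.of_le hk
    rw [Nat.cast_add, Nat.cast_one, contDiff_succ_iff_hasFDerivAt]
    refine ⟨_, ?_, hs⟩
    have : ContDiff ℝ k fun x => (A x).flip :=
      (ContinuousLinearMap.flipₗᵢ ℝ V F F).contDiff.comp hAk
    fun_prop

/-- A parallel section that vanishes at one point vanishes everywhere, by uniqueness for the linear
equation it satisfies on segments. -/
theorem parallel_section_eq_zero (hA : Continuous A)
    (hs : ∀ x, HasFDerivAt s (-((A x).flip (s x))) x) {x : V} (hx : s x = 0) (y : V) :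
    s y = 0 := by
  have hline : ∀ t : ℝ, HasDerivAt (fun t : ℝ => x + t • (y - x)) (y - x) t := fun t => by
    simpa using ((hasDerivAt_id t).smul_const (y - x)).const_add x
  have := eq_zero_of_hasDerivAt_linear (B := fun t => -(A (x + t • (y - x)) (y - x)))
    (y := fun t => s (x + t • (y - x))) (by fun_prop)
    (fun t => ((hs _).comp_hasDerivAt t (hline t)).congr_deriv (by simp)) (by simpa using hx)
  simpa using this

end ParallelSection

/-! ### Smooth antiderivatives in a direction -/

section Antiderivative

universe u

variable {V : Type u} [NormedAddCommGroup V] [NormedSpace ℝ V]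

theorem hasFDerivAt_integral_unitInterval {F : Type*} [NormedAddCommGroup F] [NormedSpace ℝ F]
    {f : ℝ × V → F} (hf : ContDiff ℝ 1 f) (x : V) :
    HasFDerivAt (fun x => ∫ t in (0 : ℝ)..1, f (t, x))
      (∫ t in (0 : ℝ)..1, (fderiv ℝ f (t, x)).comp (ContinuousLinearMap.inr ℝ ℝ V)) x := by
  let f' : ℝ × V → V →L[ℝ] F := fun p => (fderiv ℝ f p).comp (ContinuousLinearMap.inr ℝ ℝ V)
  have hf' : ∀ t x, HasFDerivAt (fun x => f (t, x)) (f' (t, x)) x := fun t x =>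
    ((hf.differentiable (by simp)) (t, x)).hasFDerivAt.comp x (hasFDerivAt_prodMk_right t x)
  have hfc := hf.continuous
  have hc : Continuous f' := (hf.continuous_fderiv (by simp)).clm_comp continuous_const
  obtain ⟨C, hC⟩ := (isCompact_Icc (a := (0 : ℝ)) (b := 1)).exists_bound_of_continuousOn
    (f := fun t => f' (t, x)) (by fun_prop)
  have hev : ∀ᶠ y in nhds x, ∀ t ∈ Icc (0 : ℝ) 1, ‖f' (t, y)‖ < C + 1 := by
    refine isCompact_Icc.eventually_forall_of_forall_eventually fun t ht => ?_
    have hc' : Continuous fun z : V × ℝ => ‖f' (z.2, z.1)‖ := by fun_prop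
    refine hc'.continuousAt.eventually_lt continuousAt_const ?_
    exact (hC t ht).trans_lt (lt_add_one C)
  refine intervalIntegral.hasFDerivAt_integral_of_dominated_of_fderiv_le (bound := fun _ => C + 1)
    (F' := fun x t => f' (t, x)) hev ?_ ?_ ?_ ?_ ?_ ?_
  · exact Filter.Eventually.of_forall fun y => Continuous.aestronglyMeasurable (by fun_prop)
  · exact Continuous.intervalIntegrable (by fun_prop) _ _
  · exact Continuous.aestronglyMeasurable (by fun_prop)
  · refine Filter.Eventually.of_forall fun t ht y hy => (hy t ?_).le
    rw [uIoc_of_le zero_le_one] at ht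
    exact ⟨ht.1.le, ht.2⟩
  · exact Continuous.intervalIntegrable (by fun_prop) _ _
  · exact Filter.Eventually.of_forall fun t _ y _ => hf' t y

theorem contDiff_integral_unitInterval {F : Type u} [NormedAddCommGroup F] [NormedSpace ℝ F]
    {f : ℝ × V → F} (hf : ContDiff ℝ ∞ f) : ContDiff ℝ ∞ fun x => ∫ t in (0 : ℝ)..1, f (t, x) := by
  rw [contDiff_infty]
  intro k
  induction k generalizing F with
  | zero =>
    exact contDiff_zero.2 (continuous_iff_continuousAt.2 fun x =>
      (hasFDerivAt_integral_unitInterval (hf.of_le (by simp)) x).continuousAt)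
  | succ k ih =>
    rw [Nat.cast_add, Nat.cast_one, contDiff_succ_iff_hasFDerivAt]
    exact ⟨_, ih ((hf.fderiv_right (m := ∞) (by simp)).clm_comp contDiff_const),
      hasFDerivAt_integral_unitInterval (hf.of_le (by simp))⟩

/-- A smooth map has a smooth antiderivative in any direction `v` on which some functional `l` takes
the value `1`: integrate from the hyperplane `l = 0` along lines parallel to `v`. -/
theorem exists_contDiff_fderiv_apply_eq {F : Type u} [NormedAddCommGroup F] [NormedSpace ℝ F]
    [CompleteSpace F] {X : V → F} (hX : ContDiff ℝ ∞ X) {v : V} {l : V →L[ℝ] ℝ} (hl : l v = 1) :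
    ∃ G : V → F, ContDiff ℝ ∞ G ∧ ∀ y, fderiv ℝ G y v = X y := by
  let G : V → F := fun y => l y • ∫ t in (0 : ℝ)..1, X (y + ((t - 1) * l y) • v)
  have hG : ContDiff ℝ ∞ G := by
    have h1 : ContDiff ℝ ∞ fun p : ℝ × V => X (p.2 + ((p.1 - 1) * l p.2) • v) :=
      hX.comp (by fun_prop)
    have := contDiff_integral_unitInterval h1
    fun_prop
  refine ⟨G, hG, fun y => ?_⟩
  have hXc := hX.continuous
  have hline : ∀ r : ℝ, G (y + r • v) = ∫ s in (0 : ℝ)..(l y + r), X (y - l y • v + s • v) := by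
    intro r
    have h2 := intervalIntegral.smul_integral_comp_mul_right (a := 0) (b := 1)
      (fun s => X (y - l y • v + s • v)) (l y + r)
    simp only [zero_mul, one_mul] at h2
    rw [← h2]
    simp only [G, map_add, map_smul, hl, smul_eq_mul, mul_one]
    congr 2
    ext t
    congr 1
    module
  have h1 : HasDerivAt (fun r : ℝ => G (y + r • v)) (X y) 0 := by
    simp only [hline]
    have hc : Continuous fun s : ℝ => X (y - l y • v + s • v) := by fun_prop
    have h3 := (hc.integral_hasStrictDerivAt 0 (l y + 0)).hasDerivAt.comp_const_add (l y) 0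
    simpa using h3
  have h4 : HasDerivAt (fun r : ℝ => y + r • v) v 0 := by
    simpa using ((hasDerivAt_id (0 : ℝ)).smul_const v).const_add y
  exact ((hG.differentiable (by simp) y).hasFDerivAt.comp_hasDerivAt_of_eq (0 : ℝ) h4
    (by simp)).unique h1

end Antiderivative

/-! ### Vector fields in a global coordinate system -/

section Coordinates

theorem mlieBracket_eq_lieBracket {E : Type*} [NormedAddCommGroup E] [NormedSpace ℝ E]
    {V W : Π x : E, TangentSpace 𝓘(ℝ, E) x} : mlieBracket 𝓘(ℝ, E) V W = lieBracket ℝ V W := by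
  rw [← mlieBracketWithin_univ, mlieBracketWithin_eq_lieBracketWithin]
  exact lieBracketWithin_univ

variable {n : ℕ} {N : Type*} [TopologicalSpace N] [ChartedSpace (EuclideanSpace ℝ (Fin n)) N]
  (φ : N ≃ₘ⟮𝓡 n, 𝓡 n⟯ EuclideanSpace ℝ (Fin n))

/-- The expression `f ∘ φ⁻¹` of a function in the chart `φ`. -/
def coordFun (f : SmoothFun n N) : EuclideanSpace ℝ (Fin n) → ℝ := fun y => f (φ.symm y)

theorem contDiff_coordFun (f : SmoothFun n N) : ContDiff ℝ ∞ (coordFun φ f) :=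
  (f.contMDiff.comp φ.symm.contMDiff).contDiff

/-- The function on `N` with expression `g` in the chart `φ`. -/
def ofCoordFun (g : EuclideanSpace ℝ (Fin n) → ℝ) (hg : ContDiff ℝ ∞ g) : SmoothFun n N :=
  ⟨fun x => g (φ x), hg.contMDiff.comp φ.contMDiff⟩

@[simp] theorem ofCoordFun_apply (g : EuclideanSpace ℝ (Fin n) → ℝ) (hg : ContDiff ℝ ∞ g) (x : N) :
    ofCoordFun φ g hg x = g (φ x) := rfl

/-- The differential of the chart `φ` at `x`, as an isomorphism onto the model space. -/
def chartDeriv (x : N) : TangentSpace (𝓡 n) x ≃L[ℝ] EuclideanSpace ℝ (Fin n) :=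
  φ.mfderivToContinuousLinearEquiv (by simp) x

theorem mpullback_chart_apply (f : EuclideanSpace ℝ (Fin n) → EuclideanSpace ℝ (Fin n)) (x : N) :
    mpullback (𝓡 n) (𝓡 n) φ f x = (chartDeriv φ x).symm (f (φ x)) :=
  congrArg (fun L : EuclideanSpace ℝ (Fin n) →L[ℝ] TangentSpace (𝓡 n) x => L (f (φ x)))
    (ContinuousLinearMap.inverse_equiv (chartDeriv φ x))

variable [IsManifold (𝓡 n) ∞ N]

/-- The expression of the vector field `X` in the chart `φ`: the map `y ↦ dφ (X)` at `φ⁻¹ y`. -/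
def coord (X : VField n N) : EuclideanSpace ℝ (Fin n) → EuclideanSpace ℝ (Fin n) :=
  fun y => chartDeriv φ (φ.symm y) (X (φ.symm y))

theorem coord_apply (X : VField n N) (x : N) : coord φ X (φ x) = chartDeriv φ x (X x) :=
  congrArg (fun z => chartDeriv φ z (X z)) (φ.symm_apply_apply x)

theorem contDiff_coord (X : VField n N) : ContDiff ℝ ∞ (coord φ X) := by
  have h := ((φ.contMDiff.contMDiff_tangentMap (m := ∞) (by simp)).comp X.contMDiff).comp
    φ.symm.contMDiff
  exact ((contMDiff_snd_tangentBundle_modelSpace _ (𝓡 n)).comp h).contDiff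

theorem coord_eq_zero_iff {X : VField n N} {x : N} : coord φ X (φ x) = 0 ↔ X x = 0 := by
  rw [coord_apply, map_eq_zero_iff _ (chartDeriv φ x).injective]

theorem coord_injective : Function.Injective (coord φ : VField n N → _) := fun X Y h => by
  ext x : 1
  apply (chartDeriv φ x).injective
  rw [← coord_apply, ← coord_apply, h]

/-- The vector field with expression `f` in the chart `φ`. -/
def ofCoord (f : EuclideanSpace ℝ (Fin n) → EuclideanSpace ℝ (Fin n)) (hf : ContDiff ℝ ∞ f) :
    VField n N :=
  ⟨fun x => (chartDeriv φ x).symm (f (φ x)), by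
    have : IsManifold (𝓡 n) (((⊤ : ℕ∞) : WithTop ℕ∞) + 1) N :=
      inferInstanceAs (IsManifold (𝓡 n) ∞ N)
    have h := ContMDiff.mpullback_vectorField (m := ∞) (n := ∞)
      (contMDiff_vectorSpace_iff_contDiff.2 hf) φ.contMDiff (fun x => ⟨chartDeriv φ x, rfl⟩)
      (by simp)
    refine h.congr fun x => ?_
    rw [mpullback_chart_apply]⟩

@[simp] theorem coord_ofCoord (f : EuclideanSpace ℝ (Fin n) → EuclideanSpace ℝ (Fin n))
    (hf : ContDiff ℝ ∞ f) : coord φ (ofCoord φ f hf) = f := by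
  ext1 y
  simp only [coord, ofCoord, ContMDiffSection.coeFn_mk, ContinuousLinearEquiv.apply_symm_apply,
    Diffeomorph.apply_symm_apply]

theorem coord_add (X Y : VField n N) : coord φ (X + Y) = coord φ X + coord φ Y :=
  funext fun _ => map_add (chartDeriv φ _) _ _

theorem coord_sub (X Y : VField n N) : coord φ (X - Y) = coord φ X - coord φ Y :=
  funext fun _ => map_sub (chartDeriv φ _) _ _

theorem coord_zero : coord φ (0 : VField n N) = 0 :=
  funext fun _ => map_zero (chartDeriv φ _)

theorem coord_smul (f : SmoothFun n N) (X : VField n N) :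
    coord φ (f • X) = coordFun φ f • coord φ X :=
  funext fun _ => map_smul (chartDeriv φ _) _ _

theorem act_eq_fderiv (X : VField n N) (f : SmoothFun n N) (x : N) :
    act X f x = fderiv ℝ (coordFun φ f) (φ x) (coord φ X (φ x)) := by
  have h1 : MDifferentiableAt (𝓡 n) 𝓘(ℝ, ℝ) (coordFun φ f) (φ x) :=
    (contDiff_coordFun φ f).contMDiff.mdifferentiableAt (by simp)
  have h2 : MDifferentiableAt (𝓡 n) (𝓡 n) φ x := φ.contMDiff.mdifferentiableAt (by simp)
  have h3 : (⇑f) = coordFun φ f ∘ φ := by ext x; simp [coordFun]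
  have h4 : mfderiv (𝓡 n) 𝓘(ℝ, ℝ) f x
      = (mfderiv (𝓡 n) 𝓘(ℝ, ℝ) (coordFun φ f) (φ x)).comp (mfderiv (𝓡 n) (𝓡 n) φ x) := by
    conv_lhs => rw [h3]
    exact mfderiv_comp x h1 h2
  rw [coord_apply, ← mfderiv_eq_fderiv]
  exact congrArg (fun L : TangentSpace (𝓡 n) x →L[ℝ] ℝ => L (X x)) h4

theorem coord_bracket (X Y : VField n N) :
    coord φ (bracket X Y) = lieBracket ℝ (coord φ X) (coord φ Y) := by
  have hd : ∀ Z : VField n N, ∀ y, MDifferentiableAt (𝓡 n) (𝓡 n).tangent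
      (fun y => (⟨y, coord φ Z y⟩ : TangentBundle (𝓡 n) (EuclideanSpace ℝ (Fin n)))) y := fun Z y =>
    (contMDiff_vectorSpace_iff_contDiff.2 (contDiff_coord φ Z)).mdifferentiableAt (by simp)
  have he : ∀ Z : VField n N, (⇑Z : Π x : N, TangentSpace (𝓡 n) x)
      = mpullback (𝓡 n) (𝓡 n) φ (coord φ Z) := fun Z => by
    ext1 x
    rw [mpullback_chart_apply, coord_apply, ContinuousLinearEquiv.symm_apply_apply]
  have : IsManifold (𝓡 n) (minSmoothness ℝ 2) N := by
    rw [minSmoothness_of_isRCLikeNormedField]; infer_instance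
  have : IsManifold (𝓡 n) (minSmoothness ℝ 3) N := by
    rw [minSmoothness_of_isRCLikeNormedField]; infer_instance
  have h2 : minSmoothness ℝ 2 ≤ ∞ := by
    rw [minSmoothness_of_isRCLikeNormedField]; exact ENat.LEInfty.out
  have hv : mlieBracket (𝓡 n) (coord φ X) (coord φ Y) = lieBracket ℝ (coord φ X) (coord φ Y) :=
    mlieBracket_eq_lieBracket
  have hb : ∀ x : N, bracket X Y x
      = (chartDeriv φ x).symm (lieBracket ℝ (coord φ X) (coord φ Y) (φ x)) := fun x => by
    have := mpullback_mlieBracket (x₀ := x) (n := ∞) (hd X _) (hd Y _)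
      φ.contMDiff.contMDiffAt h2
    rw [← he, ← he, hv, mpullback_chart_apply] at this
    exact this.symm
  ext1 y
  obtain ⟨x, rfl⟩ : ∃ x, φ x = y := ⟨φ.symm y, φ.apply_symm_apply y⟩
  rw [coord_apply, hb, ContinuousLinearEquiv.apply_symm_apply]

end Coordinates

/-! ### Commutators of Leibniz operators -/

namespace LeibnizOp

variable {A : Type*} [CommRing A] {d d₁ d₂ d₃ : A → A}
  {N : Type*} [AddCommGroup N] [Module A N] {P : Type*} [AddCommGroup P] [Module A P]

/-- `δ` as an additive map. -/
def toAddMonoidHom (δ : LeibnizOp d N) : N →+ N := AddMonoidHom.mk' δ δ.map_add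

theorem map_zero (δ : LeibnizOp d N) : δ 0 = 0 := δ.toAddMonoidHom.map_zero

theorem map_sub (δ : LeibnizOp d N) (m m' : N) : δ (m - m') = δ m - δ m' :=
  δ.toAddMonoidHom.map_sub m m'

theorem map_sum (δ : LeibnizOp d N) {ι : Type*} (s : Finset ι) (m : ι → N) :
    δ (∑ i ∈ s, m i) = ∑ i ∈ s, δ (m i) := _root_.map_sum δ.toAddMonoidHom m s

/-- The relation `[δ₁, δ₂] = δ₃` between operators on `N`. -/
def IsCommutator (δ₁ : LeibnizOp d₁ N) (δ₂ : LeibnizOp d₂ N) (δ₃ : LeibnizOp d₃ N) : Prop :=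
  ∀ m, δ₁ (δ₂ m) - δ₂ (δ₁ m) = δ₃ m

variable {δ₁ : LeibnizOp d₁ N} {δ₂ : LeibnizOp d₂ N} {δ₃ : LeibnizOp d₃ N}
  {ε₁ : LeibnizOp d₁ P} {ε₂ : LeibnizOp d₂ P} {ε₃ : LeibnizOp d₃ P}

theorem IsCommutator.hom (hδ : IsCommutator δ₁ δ₂ δ₃) (hε : IsCommutator ε₁ ε₂ ε₃) :
    IsCommutator (hom δ₁ ε₁) (LeibnizOp.hom δ₂ ε₂) (LeibnizOp.hom δ₃ ε₃) := by
  intro α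
  ext m
  simp only [LeibnizOp.hom, LinearMap.sub_apply, LinearMap.coe_mk, AddHom.coe_mk, ← hδ m,
    ← hε (α m), map_sub, _root_.map_sub]
  abel

/-- In the commutator on multilinear maps the terms in which `δ₁` and `δ₂` hit different arguments
are symmetric in the two operators and cancel. -/
theorem IsCommutator.multilinear {k : ℕ} (hδ : IsCommutator δ₁ δ₂ δ₃)
    (hε : IsCommutator ε₁ ε₂ ε₃) :
    IsCommutator (multilinear k δ₁ ε₁) (LeibnizOp.multilinear k δ₂ ε₂)
      (LeibnizOp.multilinear k δ₃ ε₃) := by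
  intro T
  ext m
  have hD : ∀ {d d' : A → A} (δ : LeibnizOp d N) (δ' : LeibnizOp d' N) (i j : Fin k),
      T (Function.update (Function.update m i (δ (m i))) j
        (δ' (Function.update m i (δ (m i)) j)))
      = (if i = j then T (Function.update m i (δ' (δ (m i)))) else 0)
        + (if i = j then 0 else
          T (Function.update (Function.update m i (δ (m i))) j (δ' (m j)))) := by
    intro d d' δ δ' i j
    by_cases h : i = j
    · subst h; simp
    · simp [h, Function.update_of_ne (Ne.symm h)]
  have hsymm : ∑ i, ∑ j, (if i = j then 0 else
        T (Function.update (Function.update m i (δ₁ (m i))) j (δ₂ (m j))))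
      = ∑ i, ∑ j, (if i = j then 0 else
        T (Function.update (Function.update m i (δ₂ (m i))) j (δ₁ (m j)))) := by
    rw [Finset.sum_comm]
    refine Finset.sum_congr rfl fun i _ => Finset.sum_congr rfl fun j _ => ?_
    by_cases h : i = j
    · simp [h]
    · simp [h, Ne.symm h, Function.update_comm h]
  have hT : ∀ i, T (Function.update m i (δ₃ (m i)))
      = T (Function.update m i (δ₁ (δ₂ (m i)))) - T (Function.update m i (δ₂ (δ₁ (m i)))) := by
    intro i
    rw [← hδ, T.map_update_sub]
  simp only [LeibnizOp.multilinear, _root_.sub_apply, MultilinearMap.coe_mk, map_sub, map_sum,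
    hD, Finset.sum_sub_distrib, Finset.sum_add_distrib, Finset.sum_ite_eq, Finset.mem_univ,
    if_true, hT,
    ← hε (T m), hsymm]
  abel

end LeibnizOp

variable {n : ℕ} {N : Type*} [TopologicalSpace N] [ChartedSpace (EuclideanSpace ℝ (Fin n)) N]
  [IsManifold (𝓡 n) ∞ N] (φ : N ≃ₘ⟮𝓡 n, 𝓡 n⟯ EuclideanSpace ℝ (Fin n))

/-! ### Tensoriality -/

section Tensoriality

/-- The vector field with constant coordinate expression `v`. -/
def constField (v : EuclideanSpace ℝ (Fin n)) : VField n N := ofCoord φ (fun _ => v) contDiff_const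

@[simp] theorem coord_constField (v : EuclideanSpace ℝ (Fin n)) :
    coord φ (constField φ v) = fun _ => v := coord_ofCoord φ _ _

/-- The coordinate one-form `dxⁱ`. -/
def coordForm (i : Fin n) : OneForm n N where
  toFun Y := ofCoordFun φ (fun y => coord φ Y y i) (by have := contDiff_coord φ Y; fun_prop)
  map_add' X Y := by ext x; simp [coord_add]
  map_smul' f X := by ext x; simp [coord_smul, coordFun]

@[simp] theorem coordForm_apply (i : Fin n) (Y : VField n N) (x : N) :
    coordForm φ i Y x = coord φ Y (φ x) i := rfl

theorem coord_sum {ι : Type*} (s : Finset ι) (Y : ι → VField n N) :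
    coord φ (∑ i ∈ s, Y i) = ∑ i ∈ s, coord φ (Y i) :=
  map_sum (AddMonoidHom.mk' (coord φ) (coord_add φ)) Y s

theorem sum_coordForm_smul (Y : VField n N) :
    ∑ i, coordForm φ i Y • constField φ (EuclideanSpace.single i (1 : ℝ)) = Y := by
  apply coord_injective φ
  ext y j
  simp [coord_sum, coord_smul, coordFun, Finset.sum_apply, Pi.single_apply]

theorem sum_smul_coordForm (α : OneForm n N) :
    ∑ i, α (constField φ (EuclideanSpace.single i (1 : ℝ))) • coordForm φ i = α := by
  ext1 Y
  conv_rhs => rw [← sum_coordForm_smul φ Y, map_sum]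
  rw [LinearMap.sum_apply]
  refine Finset.sum_congr rfl fun i _ => ?_
  rw [LinearMap.smul_apply, map_smul, smul_eq_mul, smul_eq_mul, mul_comm]

variable {W : Type*} [AddCommGroup W] [Module ℝ W] {x : N}

/-- An operator that is function-linear up to evaluation at `x` depends only on the value at `x`. -/
theorem eq_zero_of_apply_eq_zero (φ : N ≃ₘ⟮𝓡 n, 𝓡 n⟯ EuclideanSpace ℝ (Fin n))
    (T : VField n N →+ W)
    (hT : ∀ (f : SmoothFun n N) Y, T (f • Y) = f x • T Y) {Y : VField n N} (hY : Y x = 0) :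
    T Y = 0 := by
  rw [← sum_coordForm_smul φ Y, map_sum]
  refine Finset.sum_eq_zero fun i _ => ?_
  rw [hT, coordForm_apply, (coord_eq_zero_iff φ).2 hY, PiLp.zero_apply, zero_smul]

theorem eq_zero_of_form_apply_eq_zero (φ : N ≃ₘ⟮𝓡 n, 𝓡 n⟯ EuclideanSpace ℝ (Fin n))
    (T : OneForm n N →+ W)
    (hT : ∀ (f : SmoothFun n N) α, T (f • α) = f x • T α) {α : OneForm n N}
    (hα : ∀ Y, α Y x = 0) : T α = 0 := by
  rw [← sum_smul_coordForm φ α, map_sum]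
  refine Finset.sum_eq_zero fun i _ => ?_
  rw [hT, hα, zero_smul]

/-- An operator that is function-linear up to evaluation at `x` vanishes if it vanishes on a frame.
Only the values of the frame at `x` are used, with constant coefficients, so no smoothness of the
components in the frame is needed. -/
theorem eq_zero_of_frame (φ : N ≃ₘ⟮𝓡 n, 𝓡 n⟯ EuclideanSpace ℝ (Fin n))
    {E : Fin n → VField n N} (hE : IsFrame E) (T : VField n N →+ W)
    (hT : ∀ (f : SmoothFun n N) Y, T (f • Y) = f x • T Y) (h0 : ∀ j, T (E j) = 0)
    (Y : VField n N) : T Y = 0 := by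
  let c : Fin n → SmoothFun n N := fun j => ⟨fun _ => hE.coeff j x (Y x), contMDiff_const⟩
  have hx : (Y - ∑ j, c j • E j) x = 0 := by
    have h := hE.coeff_sum_eq Y (mem_univ x)
    rw [ContMDiffSection.coe_sub, Pi.sub_apply, sub_eq_zero]
    have hs : (⇑(∑ j, c j • E j) : Π x : N, TangentSpace (𝓡 n) x) = ∑ j, ⇑(c j • E j) :=
      map_sum (ContMDiffSection.coeAddHom _ _ _ _) _ _
    rw [hs, Finset.sum_apply]
    exact h
  have := eq_zero_of_apply_eq_zero φ T hT hx
  rw [map_sub, sub_eq_zero] at this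
  rw [this, map_sum]
  exact Finset.sum_eq_zero fun j _ => by rw [hT, h0, smul_zero]

end Tensoriality

/-! ### The action of vector fields on functions -/

theorem coordFun_act (X : VField n N) (f : SmoothFun n N) :
    coordFun φ (act X f) = fun y => fderiv ℝ (coordFun φ f) y (coord φ X y) := by
  ext y
  simp only [coordFun, act_eq_fderiv φ, Diffeomorph.apply_symm_apply]

/-- `[X, Y]` acts on functions as the commutator of `X` and `Y`; in the chart this is the symmetry of
the second derivative. -/
theorem act_act_sub (φ : N ≃ₘ⟮𝓡 n, 𝓡 n⟯ EuclideanSpace ℝ (Fin n)) (X Y : VField n N)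
    (f : SmoothFun n N) :
    act X (act Y f) - act Y (act X f) = act (bracket X Y) f := by
  ext x
  have hf := contDiff_coordFun φ f
  have hf' : ContDiff ℝ ∞ (fderiv ℝ (coordFun φ f)) := hf.fderiv_right (by simp)
  have hd : ∀ Z : VField n N, fderiv ℝ (fun y => fderiv ℝ (coordFun φ f) y (coord φ Z y)) (φ x)
      = (fderiv ℝ (coordFun φ f) (φ x)).comp (fderiv ℝ (coord φ Z) (φ x))
        + (fderiv ℝ (fderiv ℝ (coordFun φ f)) (φ x)).flip (coord φ Z (φ x)) := fun Z =>
    fderiv_clm_apply (hf'.differentiable (by simp) _)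
      ((contDiff_coord φ Z).differentiable (by simp) _)
  have hsymm : IsSymmSndFDerivAt ℝ (coordFun φ f) (φ x) :=
    hf.contDiffAt.isSymmSndFDerivAt (by
      rw [minSmoothness_of_isRCLikeNormedField]; exact ENat.LEInfty.out)
  rw [ContMDiffMap.coe_sub, Pi.sub_apply, act_eq_fderiv φ, act_eq_fderiv φ, act_eq_fderiv φ,
    coordFun_act, coordFun_act, hd, hd, coord_bracket, lieBracket_eq]
  simp only [_root_.add_apply, ContinuousLinearMap.comp_apply, ContinuousLinearMap.flip_apply,
    map_sub]
  rw [hsymm.eq (coord φ X (φ x)) (coord φ Y (φ x))]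
  ring

/-! ### Reduction of tensor fields to vector fields -/

/-- The vector field `Y` as a tensor field of type `(1, 0)`, namely `α ↦ α Y`. -/
def evalTensor (Y : VField n N) : TensorField n N 1 0 :=
  MultilinearMap.ofSubsingleton _ _ _ 0
    ((MultilinearMap.constLinearEquivOfIsEmpty (R := SmoothFun n N) (S := SmoothFun n N)
      (M₂ := SmoothFun n N) (M₁ := fun _ : Fin 0 => VField n N)).toLinearMap ∘ₗ LinearMap.applyₗ Y)

@[simp] theorem evalTensor_apply (Y : VField n N) (α : Fin 1 → OneForm n N)
    (Z : Fin 0 → VField n N) : evalTensor Y α Z = α 0 Y := rfl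

theorem apply_eq_zero_of_forall_form (φ : N ≃ₘ⟮𝓡 n, 𝓡 n⟯ EuclideanSpace ℝ (Fin n))
    {Y : VField n N} {x : N} (h : ∀ α : OneForm n N, α Y x = 0) : Y x = 0 := by
  rw [← coord_eq_zero_iff φ]
  ext i
  exact h (coordForm φ i)

namespace SDerivation

variable (D : SDerivation n N)

theorem onTensor_evalTensor (X Y : VField n N) :
    D.onTensor 1 0 X (evalTensor Y) = evalTensor (D.onVField X Y) := by
  ext α Z x
  simp [onTensor, LeibnizOp.multilinear, LeibnizOp.hom]

/-- Flatness on all tensor fields is flatness on vector fields, since `D_X` on tensors is built from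
`D_X` on vector fields and the Lie derivative on functions. -/
theorem isFlat_iff (φ : N ≃ₘ⟮𝓡 n, 𝓡 n⟯ EuclideanSpace ℝ (Fin n)) :
    D.IsFlat ↔ ∀ X Y, LeibnizOp.IsCommutator (D.onVField X) (D.onVField Y)
      (D.onVField (bracket X Y)) := by
  constructor
  · intro h X Y Z
    have hev := h X Y 1 0 (evalTensor Z)
    simp only [curvature, onTensor_evalTensor] at hev
    rw [← sub_eq_zero]
    ext1 x
    refine apply_eq_zero_of_forall_form φ fun α => ?_
    have := congrArg (fun T : TensorField n N 1 0 => T (fun _ => α) (fun _ => 0) x) hev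
    simp only [_root_.sub_apply, evalTensor_apply, ← map_sub] at this
    exact this
  · intro h X Y p q T
    have hf : LeibnizOp.IsCommutator (onFun X) (onFun Y) (onFun (bracket X Y)) :=
      act_act_sub φ X Y
    exact sub_eq_zero.2 (LeibnizOp.IsCommutator.multilinear ((h X Y).hom hf)
      ((h X Y).multilinear hf) T)

/-- The condition that `D_X` vanishes where `X` does may be tested on vector fields. -/
theorem vanishesWithField_iff (φ : N ≃ₘ⟮𝓡 n, 𝓡 n⟯ EuclideanSpace ℝ (Fin n)) :
    D.VanishesWithField ↔ ∀ (X : VField n N) (x : N), X x = 0 → ∀ Y, D.onVField X Y x = 0 := by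
  constructor
  · intro h X x hX Y
    refine apply_eq_zero_of_forall_form φ fun α => ?_
    have := h X x hX 1 0 (evalTensor Y) (fun _ => α) (fun _ => 0)
    rwa [onTensor_evalTensor] at this
  · intro h X x hX p q T α Y
    have hact : ∀ f, act X f x = 0 := fun f => by rw [act_apply, hX, map_zero]
    have hV : ∀ b, T α (Function.update Y b (D.onVField X (Y b))) x = 0 := fun b =>
      eq_zero_of_apply_eq_zero φ (AddMonoidHom.mk' (fun Z => T α (Function.update Y b Z) x)
        (fun Z Z' => by simp)) (fun f Z => by simp) (h X x hX (Y b))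
    have hF : ∀ a, T (Function.update α a
        (LeibnizOp.hom (D.onVField X) (onFun X) (α a))) Y x = 0 := fun a => by
      refine eq_zero_of_form_apply_eq_zero φ (x := x)
        (AddMonoidHom.mk' (fun β => T (Function.update α a β) Y x)
        (fun β β' => by simp)) (fun f β => by simp) (fun Z => ?_)
      have h1 := h X x hX Z
      have h2 : α a (D.onVField X Z) x = 0 :=
        eq_zero_of_apply_eq_zero φ (AddMonoidHom.mk' (fun Z => α a Z x) (fun Z Z' => by simp))
          (fun f Z => by simp) h1
      have : LeibnizOp.hom (D.onVField X) (onFun X) (α a) Z x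
          = act X (α a Z) x - α a (D.onVField X Z) x := rfl
      rw [this, hact, h2, sub_zero]
    have hsum : ∀ {ι : Type} [Fintype ι] (f : ι → SmoothFun n N), (∀ i, f i x = 0) →
        (∑ i, f i) x = 0 := fun f hf => by
      rw [← ContMDiffMap.coeFnAddMonoidHom_apply, map_sum, Finset.sum_apply]
      exact Finset.sum_eq_zero fun i _ => hf i
    have hD : D.onTensor p q X T α Y x = act X (T α Y) x
        - (∑ b, T α (Function.update Y b (D.onVField X (Y b)))) x
        - (∑ a, T (Function.update α a (LeibnizOp.hom (D.onVField X) (onFun X) (α a)))) Y x := rfl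
    rw [hD, hact, hsum _ hV, _root_.sum_apply, hsum _ hF]
    simp

end SDerivation

/-! ### The coordinate expression of `D` -/

/-- The expression of the tensor field `S` of type (1,1) in the chart `φ`. -/
def coordEnd (S : EndField n N) (y : EuclideanSpace ℝ (Fin n)) :
    EuclideanSpace ℝ (Fin n) →L[ℝ] EuclideanSpace ℝ (Fin n) :=
  (chartDeriv φ (φ.symm y)).toContinuousLinearMap ∘L S (φ.symm y) ∘L
    (chartDeriv φ (φ.symm y)).symm.toContinuousLinearMap

theorem coord_app (S : EndField n N) (Y : VField n N) (y : EuclideanSpace ℝ (Fin n)) :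
    coord φ (S.app Y) y = coordEnd φ S y (coord φ Y y) := by
  simp only [coord, coordEnd, ContinuousLinearMap.comp_apply, ContinuousLinearEquiv.coe_coe]
  rw [ContinuousLinearEquiv.symm_apply_apply]
  rfl

theorem contDiff_coordEnd (S : EndField n N) : ContDiff ℝ ∞ (coordEnd φ S) := by
  rw [contDiff_clm_apply_iff]
  intro w
  have := contDiff_coord φ (S.app (constField φ w))
  have h : (fun y => coordEnd φ S y w) = coord φ (S.app (constField φ w)) := by
    ext1 y
    rw [coord_app, coord_constField]
  rwa [h]

namespace SDerivation

variable (D : SDerivation n N)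

theorem coord_onVField (X Y : VField n N) (y : EuclideanSpace ℝ (Fin n)) :
    coord φ (D.onVField X Y) y = fderiv ℝ (coord φ Y) y (coord φ X y)
      - fderiv ℝ (coord φ X) y (coord φ Y y) + coordEnd φ (D.S X) y (coord φ Y y) := by
  have : coord φ (D.onVField X Y) = coord φ (bracket X Y) + coord φ ((D.S X).app Y) :=
    coord_add φ _ _
  rw [this, coord_bracket, Pi.add_apply, coord_app, lieBracket_eq]

theorem coord_onVField_constField (v : EuclideanSpace ℝ (Fin n)) (Y : VField n N)
    (y : EuclideanSpace ℝ (Fin n)) :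
    coord φ (D.onVField (constField φ v) Y) y = fderiv ℝ (coord φ Y) y v
      + coordEnd φ (D.S (constField φ v)) y (coord φ Y y) := by
  rw [coord_onVField, coord_constField]
  simp

end SDerivation

/-! ### Brackets with constant and radial fields -/

/-- The coordinate vector field `∂ᵢ`. -/
abbrev coordField (i : Fin n) : VField n N := constField φ (EuclideanSpace.single i (1 : ℝ))

theorem coord_bracket_constField (v : EuclideanSpace ℝ (Fin n)) (X : VField n N) :
    coord φ (bracket (constField φ v) X) = fun y => fderiv ℝ (coord φ X) y v := by
  ext1 y
  rw [coord_bracket, lieBracket_eq, coord_constField]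
  simp

theorem bracket_constField (v w : EuclideanSpace ℝ (Fin n)) :
    bracket (constField φ v) (constField φ w) = 0 := by
  apply coord_injective φ
  rw [coord_bracket_constField, coord_constField, coord_zero]
  ext1 y
  simp

/-- The Euler (radial) vector field centred at `p`. -/
def eulerField (p : N) : VField n N := ofCoord φ (fun y => y - φ p) (by fun_prop)

theorem coord_eulerField (p : N) : coord φ (eulerField φ p) = fun y => y - φ p :=
  coord_ofCoord φ _ _

theorem eulerField_self (p : N) : eulerField φ p p = 0 := by
  rw [← coord_eq_zero_iff φ, coord_eulerField]
  exact sub_self _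

theorem bracket_constField_eulerField (v : EuclideanSpace ℝ (Fin n)) (p : N) :
    bracket (constField φ v) (eulerField φ p) = constField φ v := by
  apply coord_injective φ
  rw [coord_bracket_constField, coord_constField, coord_eulerField]
  ext1 y
  rw [fderiv_sub_const, fderiv_fun_id]
  rfl

/-- `[v, [Z, F]] (p) = 0` for a constant field `v` and the radial field `Z` at `p`: in the chart
`[v, [Z, F]]` is the derivative of `∂_v F` along `Z`. -/
theorem bracket_constField_bracket_eulerField (v : EuclideanSpace ℝ (Fin n)) (p : N)
    (F : VField n N) : bracket (constField φ v) (bracket (eulerField φ p) F) p = 0 := by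
  have hF := contDiff_coord φ F
  have hF' : ContDiff ℝ ∞ (fderiv ℝ (coord φ F)) := hF.fderiv_right (by simp)
  have h1 : coord φ (bracket (eulerField φ p) F)
      = fun y => fderiv ℝ (coord φ F) y (y - φ p) - coord φ F y := by
    ext1 y
    rw [coord_bracket, lieBracket_eq, coord_eulerField]
    beta_reduce
    rw [fderiv_sub_const, fderiv_fun_id]
    rfl
  have h2 : HasFDerivAt (fun y => fderiv ℝ (coord φ F) y (y - φ p) - coord φ F y)
      ((fderiv ℝ (coord φ F) (φ p)).comp (ContinuousLinearMap.id ℝ _)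
        + (fderiv ℝ (fderiv ℝ (coord φ F)) (φ p)).flip (φ p - φ p) - fderiv ℝ (coord φ F) (φ p))
      (φ p) :=
    (((hF'.differentiable (by simp) _).hasFDerivAt).clm_apply ((hasFDerivAt_id _).sub_const _)).sub
      (hF.differentiable (by simp) _).hasFDerivAt
  rw [← coord_eq_zero_iff φ, coord_bracket_constField, h1]
  beta_reduce
  rw [h2.fderiv]
  simp

theorem exists_bracket_coordField_eq (i : Fin n) (X : VField n N) :
    ∃ F : VField n N, bracket (coordField φ i) F = X := by
  obtain ⟨G, hG, h⟩ := exists_contDiff_fderiv_apply_eq (contDiff_coord φ X)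
    (v := EuclideanSpace.single i (1 : ℝ)) (l := EuclideanSpace.proj i) (by simp)
  refine ⟨ofCoord φ G hG, coord_injective φ ?_⟩
  rw [coord_bracket_constField, coord_ofCoord]
  exact funext h

namespace SDerivation

variable (D : SDerivation n N)

/-! ### Parallel frames -/

/-- The connection form of the linear connection that agrees with `D` on the coordinate fields: it is
`S` at `∂ᵢ` on the `i`-th basis vector and is extended linearly. It need not describe `D_X` for other
fields `X`, as `X ↦ S_X` is arbitrary. -/
def connForm (y : EuclideanSpace ℝ (Fin n)) : EuclideanSpace ℝ (Fin n) →L[ℝ]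
    EuclideanSpace ℝ (Fin n) →L[ℝ] EuclideanSpace ℝ (Fin n) :=
  ∑ i, (EuclideanSpace.proj i : EuclideanSpace ℝ (Fin n) →L[ℝ] ℝ).smulRight
    (coordEnd φ (D.S (coordField φ i)) y)

theorem connForm_single (y : EuclideanSpace ℝ (Fin n)) (i : Fin n) :
    D.connForm φ y (EuclideanSpace.single i 1) = coordEnd φ (D.S (coordField φ i)) y := by
  simp [connForm, sum_apply]

theorem contDiff_connForm : ContDiff ℝ ∞ (D.connForm φ) := by
  rw [contDiff_clm_apply_iff]
  intro v
  simp only [connForm, sum_apply, ContinuousLinearMap.smulRight_apply]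
  exact ContDiff.sum fun i _ => (contDiff_coordEnd φ _).const_smul _

theorem coord_onVField_coordField (i : Fin n) (Y : VField n N) :
    coord φ (D.onVField (coordField φ i) Y) = fun y =>
      fderiv ℝ (coord φ Y) y (EuclideanSpace.single i 1)
      + D.connForm φ y (EuclideanSpace.single i 1) (coord φ Y y) := by
  ext1 y
  rw [coord_onVField_constField, connForm_single]

/-- `Y` is annihilated by every `D_{∂ᵢ}` exactly if it is parallel for `D.connForm`. -/
theorem parallel_iff {Y : VField n N} : (∀ i, D.onVField (coordField φ i) Y = 0) ↔
    ∀ y, HasFDerivAt (coord φ Y) (-((D.connForm φ y).flip (coord φ Y y))) y := by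
  have h1 : ∀ y, HasFDerivAt (coord φ Y) (fderiv ℝ (coord φ Y) y) y := fun y =>
    ((contDiff_coord φ Y).differentiable (by simp) y).hasFDerivAt
  constructor
  · intro h y
    refine (h1 y).congr_fderiv ?_
    apply ContinuousLinearMap.coe_injective
    refine (EuclideanSpace.basisFun (Fin n) ℝ).toBasis.ext fun i => ?_
    have := congrFun (congrArg (coord φ) (h i)) y
    rw [coord_onVField_coordField, coord_zero, Pi.zero_apply] at this
    simpa using eq_neg_of_add_eq_zero_left this
  · intro h i
    apply coord_injective φ
    rw [coord_onVField_coordField, coord_zero]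
    ext1 y
    rw [(h y).fderiv]
    simp

variable {D}

theorem eq_zero_of_parallel {Y : VField n N} (hY : ∀ i, D.onVField (coordField φ i) Y = 0) {p : N}
    (hp : Y p = 0) : Y = 0 := by
  apply coord_injective φ
  rw [coord_zero]
  ext1 y
  exact parallel_section_eq_zero (D.contDiff_connForm φ).continuous ((D.parallel_iff φ).1 hY)
    ((coord_eq_zero_iff φ).2 hp) y

/-- The curvature of `D.connForm` vanishes: `D_{∂ᵢ}` and `D_{∂ⱼ}` commute, as `[∂ᵢ, ∂ⱼ] = 0` and
`D_0 = 0` by the vanishing condition (which is needed, `D` not being linear). -/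
theorem connForm_flat (hflat : ∀ X Y, LeibnizOp.IsCommutator (D.onVField X) (D.onVField Y)
      (D.onVField (bracket X Y)))
    (hvan : ∀ (X : VField n N) (x : N), X x = 0 → ∀ Y, D.onVField X Y x = 0)
    (x u v w : EuclideanSpace ℝ (Fin n)) :
    fderiv ℝ (D.connForm φ) x u v w - fderiv ℝ (D.connForm φ) x v u w
      + D.connForm φ x u (D.connForm φ x v w) - D.connForm φ x v (D.connForm φ x u w) = 0 := by
  let B : EuclideanSpace ℝ (Fin n) →ₗ[ℝ] EuclideanSpace ℝ (Fin n) →ₗ[ℝ]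
      EuclideanSpace ℝ (Fin n) := LinearMap.mk₂ ℝ (fun u v =>
    fderiv ℝ (D.connForm φ) x u v w - fderiv ℝ (D.connForm φ) x v u w
      + D.connForm φ x u (D.connForm φ x v w) - D.connForm φ x v (D.connForm φ x u w))
    (fun u u' v => by simp only [map_add, _root_.add_apply]; abel)
    (fun c u v => by simp only [map_smul, _root_.smul_apply]; module)
    (fun u v v' => by simp only [map_add, _root_.add_apply]; abel)
    (fun c u v => by simp only [map_smul, _root_.smul_apply]; module)
  suffices B = 0 from congrFun (congrArg DFunLike.coe (congrFun (congrArg DFunLike.coe this) u)) v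
  have hd : ∀ i j, coord φ (D.onVField (coordField φ i)
      (D.onVField (coordField φ j) (constField φ w))) x
      = fderiv ℝ (D.connForm φ) x (EuclideanSpace.single i 1) (EuclideanSpace.single j 1) w
        + D.connForm φ x (EuclideanSpace.single i 1)
          (D.connForm φ x (EuclideanSpace.single j 1) w) := by
    intro i j
    have hA := ((D.contDiff_connForm φ).differentiable (by simp) x).hasFDerivAt
    have := (hA.clm_apply (hasFDerivAt_const (EuclideanSpace.single j (1 : ℝ)) x)).clm_apply
      (hasFDerivAt_const w x)
    rw [coord_onVField_coordField, coord_onVField_coordField, coord_constField]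
    simp only [fderiv_const_apply, _root_.zero_apply, zero_add]
    rw [this.fderiv]
    simp
  refine LinearMap.ext_basis (EuclideanSpace.basisFun (Fin n) ℝ).toBasis
    (EuclideanSpace.basisFun (Fin n) ℝ).toBasis fun i j => ?_
  have hc := congrFun (congrArg (coord φ)
    (hflat (coordField φ i) (coordField φ j) (constField φ w))) x
  have h0 : D.onVField (0 : VField n N) (constField φ w) = 0 := by
    ext1 p
    exact hvan 0 p rfl _
  rw [bracket_constField, h0, coord_sub, Pi.sub_apply, hd, hd, coord_zero, Pi.zero_apply] at hc
  simp only [OrthonormalBasis.coe_toBasis, EuclideanSpace.basisFun_apply, B, LinearMap.mk₂_apply,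
    LinearMap.zero_apply]
  rw [← hc]
  abel

theorem exists_parallel_frame (hflat : ∀ X Y, LeibnizOp.IsCommutator (D.onVField X) (D.onVField Y)
      (D.onVField (bracket X Y)))
    (hvan : ∀ (X : VField n N) (x : N), X x = 0 → ∀ Y, D.onVField X Y x = 0) :
    ∃ E : Fin n → VField n N, IsFrame E ∧ ∀ i j, D.onVField (coordField φ i) (E j) = 0 := by
  choose s hs0 hs using fun j : Fin n => exists_parallel_section (D.contDiff_connForm φ)
    (connForm_flat φ hflat hvan) (EuclideanSpace.single j (1 : ℝ))
  have hsm : ∀ j, ContDiff ℝ ∞ (s j) := fun j =>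
    contDiff_parallel_section (D.contDiff_connForm φ) (hs j)
  have hpar : ∀ i j, D.onVField (coordField φ i) (ofCoord φ (s j) (hsm j)) = 0 := fun i j =>
    (D.parallel_iff φ).2 (by rw [coord_ofCoord]; exact hs j) i
  have hind : ∀ x : N, LinearIndependent ℝ fun j => ofCoord φ (s j) (hsm j) x := by
    intro x
    have : LinearIndependent ℝ fun j => s j (φ x) := by
      rw [Fintype.linearIndependent_iff]
      intro c hc
      have h0 := parallel_section_eq_zero (s := fun y => ∑ j, c j • s j y)
        (D.contDiff_connForm φ).continuous (fun y => by
          have := HasFDerivAt.fun_sum (u := Finset.univ) fun j _ => (hs j y).const_smul (c j)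
          refine this.congr_fderiv ?_
          simp [map_sum]) hc 0
      intro j
      simpa [hs0, Pi.single_apply] using congrArg (fun v => v j) h0
    exact this.map' (chartDeriv φ x).symm.toLinearEquiv.toLinearMap (LinearEquiv.ker _)
  refine ⟨_, ⟨fun {x} _ => hind x, fun {x} _ => ?_,
    fun i => (ContMDiffSection.contMDiff _).contMDiffOn⟩, hpar⟩
  have : FiniteDimensional ℝ (TangentSpace (𝓡 n) x) :=
    inferInstanceAs (FiniteDimensional ℝ (EuclideanSpace ℝ (Fin n)))
  have hrank : Module.finrank ℝ (TangentSpace (𝓡 n) x) = n := finrank_euclideanSpace_fin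
  exact ((hind x).span_eq_top_of_card_eq_finrank' (by rw [hrank, Fintype.card_fin])).ge

/-! ### Vanishing on parallel fields -/

/-- A field `E` annihilated by all `D_{∂ᵢ}` is annihilated by every `D_X`. This replaces the linearity
of `X ↦ D_X`, which is not assumed. -/
theorem onVField_eq_zero_of_parallel
    (hflat : ∀ X Y, LeibnizOp.IsCommutator (D.onVField X) (D.onVField Y)
      (D.onVField (bracket X Y)))
    (hvan : ∀ (X : VField n N) (x : N), X x = 0 → ∀ Y, D.onVField X Y x = 0) {E : VField n N}
    (hE : ∀ i, D.onVField (coordField φ i) E = 0) (i : Fin n) (X : VField n N) :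
    D.onVField X E = 0 := by
  have hcomm : ∀ i X, D.onVField (coordField φ i) (D.onVField X E)
      = D.onVField (bracket (coordField φ i) X) E := fun i X => by
    rw [← hflat, hE, LeibnizOp.map_zero, sub_zero]
  ext1 p
  set Z := eulerField φ p with hZ
  have hZp : Z p = 0 := eulerField_self φ p
  -- `D_Z E` is parallel because `[∂ₖ, Z] = ∂ₖ`, and it vanishes at `p` with `Z`.
  have hZE : D.onVField Z E = 0 := by
    refine eq_zero_of_parallel φ (D := D) (fun k => ?_) (hvan Z p hZp E)
    rw [hcomm, hZ, bracket_constField_eulerField, hE]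
  obtain ⟨F, hF⟩ := exists_bracket_coordField_eq φ i X
  -- Apply `D_{∂ᵢ}` to `D_Z D_F E = D_{[Z, F]} E` and evaluate at `p`: the right side vanishes since
  -- `[∂ᵢ, [Z, F]]` does, and the left side is `D_{[∂ᵢ, Z]} D_F E = D_{∂ᵢ} D_F E = D_X E`.
  have h1 := hflat Z F E
  rw [hZE, LeibnizOp.map_zero, sub_zero] at h1
  have h2 := hflat (coordField φ i) Z (D.onVField F E)
  rw [h1, hcomm, hZ, bracket_constField_eulerField, hcomm, hF] at h2
  rw [← h2, ContMDiffSection.coe_sub, Pi.sub_apply,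
    hvan _ p (bracket_constField_bracket_eulerField φ _ p F), hvan _ p (eulerField_self φ p),
    sub_zero]
  rfl

end SDerivation

/-! ### Frames annihilated by all `D_X` -/

/-- The expression of a vector field, not assumed smooth, as a vector-valued function on `N`. -/
def sectionCoord (σ : Π x : N, TangentSpace (𝓡 n) x) (x : N) : EuclideanSpace ℝ (Fin n) :=
  chartDeriv φ x (σ x)

theorem mdifferentiableAt_sectionCoord {σ : Π x : N, TangentSpace (𝓡 n) x} {x : N}
    (hσ : MDifferentiableAt (𝓡 n) (𝓡 n).tangent
      (fun x => (⟨x, σ x⟩ : TotalSpace (EuclideanSpace ℝ (Fin n)) (TangentSpace (𝓡 n)))) x) :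
    MDifferentiableAt (𝓡 n) (𝓡 n) (sectionCoord φ σ) x := by
  have h1 := (φ.contMDiff.contMDiff_tangentMap (m := ∞) (by simp)).mdifferentiable (by simp)
  have h2 := (contMDiff_snd_tangentBundle_modelSpace (n := ∞) (EuclideanSpace ℝ (Fin n))
    (𝓡 n)).mdifferentiable (by simp)
  exact (h2 _).comp x ((h1 _).comp x hσ)

theorem mvfderiv_sectionCoord (Y : VField n N) (x : N) (v : TangentSpace (𝓡 n) x) :
    mvfderiv (𝓡 n) (sectionCoord φ Y) x v = fderiv ℝ (coord φ Y) (φ x) (chartDeriv φ x v) := by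
  have h1 : MDifferentiableAt (𝓡 n) (𝓡 n) (coord φ Y) (φ x) :=
    (contDiff_coord φ Y).contMDiff.mdifferentiableAt (by simp)
  have h2 : MDifferentiableAt (𝓡 n) (𝓡 n) φ x := φ.contMDiff.mdifferentiableAt (by simp)
  have h3 : sectionCoord φ Y = coord φ Y ∘ φ := funext fun x => (coord_apply φ Y x).symm
  have h4 : mfderiv (𝓡 n) (𝓡 n) (sectionCoord φ Y) x
      = (mfderiv (𝓡 n) (𝓡 n) (coord φ Y) (φ x)).comp (mfderiv (𝓡 n) (𝓡 n) φ x) := by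
    rw [h3]
    exact mfderiv_comp x h1 h2
  rw [← mfderiv_eq_fderiv]
  exact congrArg (fun L : TangentSpace (𝓡 n) x →L[ℝ] EuclideanSpace ℝ (Fin n) => L v) h4

/-- The operator `d + A` in the chart `φ`, on vector fields that need not be smooth. -/
def chartConnectionFun (A : EuclideanSpace ℝ (Fin n) → EuclideanSpace ℝ (Fin n) →L[ℝ]
    EuclideanSpace ℝ (Fin n) →L[ℝ] EuclideanSpace ℝ (Fin n))
    (σ : Π x : N, TangentSpace (𝓡 n) x) (x : N) :
    TangentSpace (𝓡 n) x →L[ℝ] TangentSpace (𝓡 n) x :=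
  (chartDeriv φ x).symm.toContinuousLinearMap ∘L
    (mvfderiv (𝓡 n) (sectionCoord φ σ) x
      + (A (φ x)).flip (sectionCoord φ σ x) ∘L (chartDeriv φ x).toContinuousLinearMap)

theorem chartDeriv_chartConnectionFun
    (A : EuclideanSpace ℝ (Fin n) → EuclideanSpace ℝ (Fin n) →L[ℝ]
    EuclideanSpace ℝ (Fin n) →L[ℝ] EuclideanSpace ℝ (Fin n))
    (σ : Π x : N, TangentSpace (𝓡 n) x) (x : N) (v : TangentSpace (𝓡 n) x) :
    chartDeriv φ x (chartConnectionFun φ A σ x v) = mvfderiv (𝓡 n) (sectionCoord φ σ) x v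
      + A (φ x) (chartDeriv φ x v) (sectionCoord φ σ x) :=
  (chartDeriv φ x).apply_symm_apply _

/-- The linear connection on the tangent bundle with connection form `A` in the chart `φ`. -/
def chartConnection (A : EuclideanSpace ℝ (Fin n) → EuclideanSpace ℝ (Fin n) →L[ℝ]
    EuclideanSpace ℝ (Fin n) →L[ℝ] EuclideanSpace ℝ (Fin n)) :
    CovariantDerivative (𝓡 n) (EuclideanSpace ℝ (Fin n))
      (TangentSpace (𝓡 n) : N → Type _) where
  toFun := chartConnectionFun φ A
  isCovariantDerivativeOnUniv :=
    { add := fun {σ σ' x} hσ hσ' _ => by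
        have h : sectionCoord φ (σ + σ') = sectionCoord φ σ + sectionCoord φ σ' :=
          funext fun x => map_add (chartDeriv φ x) _ _
        refine ContinuousLinearMap.ext fun v => (chartDeriv φ x).injective ?_
        rw [_root_.add_apply, map_add]
        simp only [chartDeriv_chartConnectionFun]
        rw [h, mvfderiv_add (mdifferentiableAt_sectionCoord φ hσ)
          (mdifferentiableAt_sectionCoord φ hσ'), Pi.add_apply, map_add, _root_.add_apply]
        abel
      leibniz := fun {σ g x} hσ hg _ => by
        have h : sectionCoord φ (g • σ) = g • sectionCoord φ σ :=
          funext fun x => map_smul (chartDeriv φ x) _ _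
        refine ContinuousLinearMap.ext fun v => (chartDeriv φ x).injective ?_
        rw [_root_.add_apply, map_add, _root_.smul_apply, map_smul,
          ContinuousLinearMap.smulRight_apply, map_smul]
        simp only [chartDeriv_chartConnectionFun]
        rw [h, mvfderiv_smul hg (mdifferentiableAt_sectionCoord φ hσ), Pi.smul_apply', map_smul,
          _root_.add_apply, _root_.smul_apply, ContinuousLinearMap.smulRight_apply, smul_add]
        simp only [sectionCoord]
        abel }

namespace SDerivation

variable {D : SDerivation n N} {E : Fin n → VField n N}

theorem onVField_eq_zero_of_components (hE : IsFrame E)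
    (h : ∀ X i j x, D.components hE X i j x = 0) (X : VField n N) (j : Fin n) :
    D.onVField X (E j) = 0 := by
  ext1 x
  rw [hE.coeff_sum_eq (D.onVField X (E j)) (mem_univ x)]
  exact Finset.sum_eq_zero fun i _ => by
    have : hE.coeff i x (D.onVField X (E j) x) = 0 := h X i j x
    rw [this, zero_smul]

/-- The curvature is function-linear on vector fields and vanishes on the frame. -/
theorem isCommutator_of_frame (φ : N ≃ₘ⟮𝓡 n, 𝓡 n⟯ EuclideanSpace ℝ (Fin n)) (hE : IsFrame E)
    (h : ∀ X j, D.onVField X (E j) = 0) (X Y : VField n N) :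
    LeibnizOp.IsCommutator (D.onVField X) (D.onVField Y) (D.onVField (bracket X Y)) := by
  intro Z
  rw [← sub_eq_zero]
  ext1 x
  let R : VField n N → VField n N := fun Z => D.onVField X (D.onVField Y Z)
    - D.onVField Y (D.onVField X Z) - D.onVField (bracket X Y) Z
  have hadd : ∀ Z Z', R (Z + Z') = R Z + R Z' := fun Z Z' => by
    simp only [R, LeibnizOp.map_add]
    abel
  have hsmul : ∀ (f : SmoothFun n N) Z, R (f • Z) = f • R Z := fun f Z => by
    simp only [R, LeibnizOp.leibniz, LeibnizOp.map_add, ← act_act_sub φ X Y f, smul_sub, sub_smul]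
    abel
  refine eq_zero_of_frame φ (x := x) hE (AddMonoidHom.mk' (fun Z => R Z x) fun Z Z' => ?_)
    (fun f Z => ?_) (fun j => ?_) Z
  · rw [hadd]; rfl
  · exact congrArg (fun V : VField n N => V x) (hsmul f Z)
  · simp only [R, AddMonoidHom.mk'_apply, h, LeibnizOp.map_zero, sub_zero]
    rfl

/-- `D_X` and the connection with form `D.connForm` differ by a function-linear operator, which
vanishes on the frame because both of them do. -/
theorem isLinearConnection_of_frame (φ : N ≃ₘ⟮𝓡 n, 𝓡 n⟯ EuclideanSpace ℝ (Fin n))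
    (hE : IsFrame E) (h : ∀ X j, D.onVField X (E j) = 0) : D.IsLinearConnection := by
  refine ⟨chartConnection φ (D.connForm φ), fun X Y x => (chartDeriv φ x).injective ?_⟩
  have hcov : chartDeriv φ x (chartConnection φ (D.connForm φ) Y x (X x))
      = mvfderiv (𝓡 n) (sectionCoord φ Y) x (X x)
      + D.connForm φ (φ x) (chartDeriv φ x (X x)) (sectionCoord φ Y x) :=
    chartDeriv_chartConnectionFun φ _ _ _ _
  have hsec : sectionCoord φ Y x = coord φ Y (φ x) := (coord_apply φ Y x).symm
  rw [hcov, mvfderiv_sectionCoord, hsec, ← coord_apply, ← coord_apply, coord_onVField]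
  let L : EuclideanSpace ℝ (Fin n) →L[ℝ] EuclideanSpace ℝ (Fin n) :=
    coordEnd φ (D.S X) (φ x) - fderiv ℝ (coord φ X) (φ x)
      - D.connForm φ (φ x) (coord φ X (φ x))
  have hL : ∀ Y, L (coord φ Y (φ x)) = 0 := fun Y => by
    refine eq_zero_of_frame φ (x := x) hE (AddMonoidHom.mk' (fun Y => L (coord φ Y (φ x)))
      fun Y Y' => ?_) (fun f Y => ?_) (fun j => ?_) Y
    · rw [coord_add, Pi.add_apply, map_add]
    · simp only [AddMonoidHom.mk'_apply, coord_smul, Pi.smul_apply', map_smul, coordFun,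
        Diffeomorph.symm_apply_apply]
    · have h1 := ((D.parallel_iff φ).1 fun i => h (coordField φ i) j) (φ x)
      have h2 := congrFun (congrArg (coord φ) (h X j)) (φ x)
      rw [coord_onVField, h1.fderiv, coord_zero, Pi.zero_apply] at h2
      rw [AddMonoidHom.mk'_apply, ← h2]
      simp only [L, _root_.sub_apply, _root_.neg_apply, ContinuousLinearMap.flip_apply]
      abel
  have := hL Y
  simp only [L, _root_.sub_apply] at this
  rw [← sub_eq_zero, ← this]
  abel

end SDerivation

end SDeriv

end

theorem proposition1 {n : ℕ} {M : Type*} [TopologicalSpace M]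
    [ChartedSpace (EuclideanSpace ℝ (Fin n)) M] [IsManifold (𝓡 n) ∞ M]
    (U : TopologicalSpace.Opens M)
    (hU : Nonempty (U ≃ₘ⟮𝓡 n, 𝓡 n⟯ EuclideanSpace ℝ (Fin n)))
    (D : SDeriv.SDerivation n U) :
    List.TFAE [
      D.IsLinearConnection ∧ D.IsFlat,
      D.IsFlat ∧ D.VanishesWithField,
      ∃ (E : Fin n → SDeriv.VField n U) (hE : SDeriv.IsFrame E),
        ∀ (X : SDeriv.VField n U) (i j : Fin n) (x : U), D.components hE X i j x = 0] := by
  obtain ⟨φ⟩ := hU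
  tfae_have 1 → 2 := by
    rintro ⟨⟨cov, hcov⟩, hflat⟩
    refine ⟨hflat, (D.vanishesWithField_iff φ).2 fun X x hX Y => ?_⟩
    rw [hcov, hX, map_zero]
  tfae_have 2 → 3 := by
    rintro ⟨hflat, hvan⟩
    rw [D.isFlat_iff φ] at hflat
    rw [D.vanishesWithField_iff φ] at hvan
    obtain ⟨E, hE, hpar⟩ := SDeriv.SDerivation.exists_parallel_frame φ hflat hvan
    refine ⟨E, hE, fun X i j x => ?_⟩
    rw [SDeriv.SDerivation.components, SDeriv.SDerivation.onVField_eq_zero_of_parallel φ hflat hvan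
      (fun i => hpar i j) i X]
    exact map_zero _
  tfae_have 3 → 1 := by
    rintro ⟨E, hE, h⟩
    have h0 := SDeriv.SDerivation.onVField_eq_zero_of_components hE h
    exact ⟨SDeriv.SDerivation.isLinearConnection_of_frame φ hE h0,
      (D.isFlat_iff φ).2 (SDeriv.SDerivation.isCommutator_of_frame φ hE h0)⟩
  tfae_finish
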